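/- Let $n,l\ge 0$ and let $H$ be a Hamiltonian (an arbitrary Hermitian operator) on $n+l$ qubits, labelled $1,\dots,n+l$. A Hamiltonian is called globally stoquastic if its matrix in the computational basis $\{|x\rangle\}$ is real and $\langle x|\cdot|y\rangle\le 0$ for all $x\ne y$. Let $X,Y,Z$ be the Pauli matrices, write $A_q$ for the single-qubit operator $A$ acting on qubit $q$, and let $W=\frac1{\sqrt2}\begin{pmatrix}1&1\\1&-1\end{pmatrix}$ be the Hadamard matrix. Add an ancilla qubit $d_j$ for each $j\in\{1,\dots,l\}$ and define, on these $n+2l$ qubits, \[G_2=\sum_{j=1}^{l}\bigl(-X_{n+j}X_{d_j}+Z_{n+j}Z_{d_j}\bigr).\] Then add three more ancilla qubits $a_u,b_u,c_u$ for each of the $n+2l$ qubits $u$ and define, with $u$ running over all $n+2l$ qubits, \[\begin{aligned}G_1=\sum_{u}\Bigl[&-(X_{c_u}+Z_{c_u})-(X_uX_{a_u}+Y_uY_{a_u}+Z_uZ_{a_u})\\&-(3X_{a_u}X_{b_u}+Y_{a_u}Y_{b_u}+2Z_{a_u}Z_{b_u})-(X_{b_u}X_{c_u}+Y_{b_u}Y_{c_u}+Z_{b_u}Z_{c_u})\Bigr].\end{aligned}\]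 Let $H_{\rm Had}=(H\otimes I+G_2)\otimes I+G_1$, a Hamiltonian on $4n+8l$ qubits. Then the following are equivalent: 1. there exists a product $U$ of single-qubit unitaries on the $4n+8l$ qubits such that $U H_{\rm Had}U^\dagger$ is globally stoquastic; 2. there exists $x\in\{0,1\}^n$ such that $W(x0^l)^\dagger H\,W(x0^l)$ is globally stoquastic, where $W(x0^l)=\bigl(\bigotimes_{i=1}^n W_i^{x_i}\bigr)\otimes\bigl(\bigotimes_{i=n+1}^{n+l}I_i\bigr)$. -/

import Mathlib

open scoped Matrix Kronecker

/-- Operators on a register of qubits labelled by `Q`, written as complex matrices in the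
computational basis `|x⟩`, `x ∈ {0,1}^Q`. -/
abbrev QubitOp (Q : Type*) := Matrix (Q → Fin 2) (Q → Fin 2) ℂ

/-- `X = |0⟩⟨1| + |1⟩⟨0|`. -/
def pauliX : Matrix (Fin 2) (Fin 2) ℂ := !![0, 1; 1, 0]

/-- The Pauli matrix `Y`. -/
def pauliY : Matrix (Fin 2) (Fin 2) ℂ := !![0, -Complex.I; Complex.I, 0]

/-- `Z = |0⟩⟨0| - |1⟩⟨1|`. -/
def pauliZ : Matrix (Fin 2) (Fin 2) ℂ := !![1, 0; 0, -1]

/-- The single-qubit Hadamard matrix `W`. -/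
noncomputable def hadamardW : Matrix (Fin 2) (Fin 2) ℂ :=
  ((Real.sqrt 2 : ℝ) : ℂ)⁻¹ • !![1, 1; 1, -1]

/-- The tensor product `⨂_q A_q` of single-qubit operators, with matrix entries
`⟨x| ⨂_q A_q |y⟩ = ∏_q ⟨x_q| A_q |y_q⟩`. -/
def tensorOp {Q : Type*} [Fintype Q] (A : Q → Matrix (Fin 2) (Fin 2) ℂ) : QubitOp Q :=
  Matrix.of fun x y => ∏ q, A q (x q) (y q)

/-- The operator `A_q`: the single-qubit operator `A` on qubit `q`, and `I` on all the others. -/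
def onQubit {Q : Type*} [Fintype Q] [DecidableEq Q] (A : Matrix (Fin 2) (Fin 2) ℂ) (q : Q) :
    QubitOp Q :=
  tensorOp (Function.update (fun _ => 1) q A)

/-- `H ⊗ I`: the operator `H` on the register `Q`, extended by the identity to the ancilla
qubits `R`; a basis state of the joint register is a pair of basis states of `Q` and `R`. -/
def extendOp {Q R : Type*} [Fintype R] [DecidableEq R] (H : QubitOp Q) : QubitOp (Q ⊕ R) :=
  Matrix.reindex (Equiv.sumArrowEquivProdArrow Q R (Fin 2)).symm
    (Equiv.sumArrowEquivProdArrow Q R (Fin 2)).symm (H ⊗ₖ (1 : QubitOp R))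

/-- A Hamiltonian (Hermitian operator) is globally stoquastic in the computational basis if all
its matrix entries are real and `⟨x| H |y⟩ ≤ 0` for all `x ≠ y`. -/
def GloballyStoquastic {Q : Type*} (H : QubitOp Q) : Prop :=
  (∀ x y, (H x y).im = 0) ∧ ∀ x y, x ≠ y → (H x y).re ≤ 0

/-- `U` is a product `⨂_q U_q` of single-qubit unitaries. -/
def IsProductUnitary {Q : Type*} [Fintype Q] (U : QubitOp Q) : Prop :=
  ∃ u : Q → Matrix (Fin 2) (Fin 2) ℂ,
    (∀ q, u q ∈ Matrix.unitaryGroup (Fin 2) ℂ) ∧ U = tensorOp u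

/-- The Hadamard pattern `W(x) = ⨂_q W_q^{x_q}` for a bit string `x`. -/
noncomputable def hadamardPattern {Q : Type*} [Fintype Q] (x : Q → Fin 2) : QubitOp Q :=
  tensorOp fun q => hadamardW ^ (x q : ℕ)

section Gadget

variable {Q : Type*}

/-- An original qubit `u`, as a qubit of the register with three ancilla qubits for each qubit. -/
def orig (u : Q) : Q ⊕ Q × Fin 3 := Sum.inl u

/-- The ancilla qubit `a_u`. -/
def ancA (u : Q) : Q ⊕ Q × Fin 3 := Sum.inr (u, 0)

/-- The ancilla qubit `b_u`. -/
def ancB (u : Q) : Q ⊕ Q × Fin 3 := Sum.inr (u, 1)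

/-- The ancilla qubit `c_u`. -/
def ancC (u : Q) : Q ⊕ Q × Fin 3 := Sum.inr (u, 2)

end Gadget

/-- The gadget Hamiltonian
`G₁ = ∑_u [ -(X_{c_u} + Z_{c_u}) - (X_u X_{a_u} + Y_u Y_{a_u} + Z_u Z_{a_u})
  - (3 X_{a_u} X_{b_u} + Y_{a_u} Y_{b_u} + 2 Z_{a_u} Z_{b_u})
  - (X_{b_u} X_{c_u} + Y_{b_u} Y_{c_u} + Z_{b_u} Z_{c_u}) ]`,
the sum being over all qubits `u` of the register `Q`. -/
noncomputable def gadgetOne (Q : Type*) [Fintype Q] [DecidableEq Q] : QubitOp (Q ⊕ Q × Fin 3) :=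
  ∑ u : Q,
    (-(onQubit pauliX (ancC u) + onQubit pauliZ (ancC u))
      - (onQubit pauliX (orig u) * onQubit pauliX (ancA u)
        + onQubit pauliY (orig u) * onQubit pauliY (ancA u)
        + onQubit pauliZ (orig u) * onQubit pauliZ (ancA u))
      - ((3 : ℂ) • (onQubit pauliX (ancA u) * onQubit pauliX (ancB u))
        + onQubit pauliY (ancA u) * onQubit pauliY (ancB u)
        + (2 : ℂ) • (onQubit pauliZ (ancA u) * onQubit pauliZ (ancB u)))
      - (onQubit pauliX (ancB u) * onQubit pauliX (ancC u)
        + onQubit pauliY (ancB u) * onQubit pauliY (ancC u)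
        + onQubit pauliZ (ancB u) * onQubit pauliZ (ancC u)))

/-- The gadget Hamiltonian `G₂ = ∑_{j=1}^l (-X_{n+j} X_{d_j} + Z_{n+j} Z_{d_j})` on the `n + l`
original qubits (left) and the ancilla qubits `d_1, …, d_l` (right). -/
noncomputable def gadgetTwo (n l : ℕ) : QubitOp (Fin (n + l) ⊕ Fin l) :=
  ∑ j : Fin l,
    (-(onQubit pauliX (Sum.inl (Fin.natAdd n j)) * onQubit pauliX (Sum.inr j))
      + onQubit pauliZ (Sum.inl (Fin.natAdd n j)) * onQubit pauliZ (Sum.inr j))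

/-- The `4n + 8l` qubits: `n + l` original ones, the `d_j`, and `a_u, b_u, c_u` for each of these
`n + 2l` qubits `u`. -/
abbrev HadQubits (n l : ℕ) : Type :=
  (Fin (n + l) ⊕ Fin l) ⊕ (Fin (n + l) ⊕ Fin l) × Fin 3

/-- `H_Had = (H ⊗ I + G₂) ⊗ I + G₁`. -/
noncomputable def hamHad {n l : ℕ} (H : QubitOp (Fin (n + l))) : QubitOp (HadQubits n l) :=
  extendOp (extendOp H + gadgetTwo n l) + gadgetOne (Fin (n + l) ⊕ Fin l)

/-! ### Tensor products of single-qubit operators and their traces -/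

section TensorProducts

open Function

variable {Q R : Type*} [Fintype Q] [Fintype R] [DecidableEq Q] [DecidableEq R]

/-! Let `U = ⨂ u_q` and let `U K Uᴴ` be stoquastic. Tracing against a product of entrywise
nonnegative matrices, one with zero diagonal, gives a nonpositive number
(`GloballyStoquastic.trace_mul_tensorOp_nonpos`), and the trace equals that of `K` against the
product of the `u_qᴴ P_q u_q`. Matrix units on one or two qubits, with the identity elsewhere, then
see a single term of the gadgets and nothing of the arbitrary `H`. In Bloch form, a coupling `∑ₖ αₖ
σₖ ⊗ σₖ` becomes `O_u diag(α) O_vᵀ`, with sign and vanishing conditions on its entries.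

On the chain `u – a_u – b_u – c_u` the two isotropic couplings carry the rows of the Bloch rotation
along, up to signs (`aligned_of_rotatedCoupling`). The coupling `(-3, -1, -2)` has distinct absolute
values, so uniqueness of singular vectors makes the rows at `b_u` coordinate vectors up to sign; the
symmetric field on `c_u` forces `Y` into the second row and fixes the sign of the first
(`rows_of_gadget`). Thus every `u_q` with `q` not among the `a, b, c` is `I` or `W` up to a phase
and a bit flip (`exists_perm_conj_single`). The coupling `-XX + ZZ` with `d_j` excludes `W` on qubit
`n+j` (`not_rotated_of_gadgetTwo`). Matrix units on the original qubits alone then read off the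
entries of `W(x0^l)† H W(x0^l)`, since bit flips merely permute basis states.

Conversely, give each `a, b, c` the Hadamard exponent of its qubit and each `d_j` exponent `0`. As
`W` swaps `X` and `Z`, every gadget term stays stoquastic (`globallyStoquastic_heisenberg`). -/

theorem tensorOp_mul (A B : Q → Matrix (Fin 2) (Fin 2) ℂ) :
    tensorOp A * tensorOp B = tensorOp (A * B) := by
  ext x y
  simp only [tensorOp, Matrix.mul_apply, Matrix.of_apply, Pi.mul_apply]
  rw [Finset.prod_univ_sum, Fintype.piFinset_univ]
  exact Finset.sum_congr rfl fun z _ => Finset.prod_mul_distrib.symm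

omit [DecidableEq Q] in
theorem tensorOp_one : tensorOp (1 : Q → Matrix (Fin 2) (Fin 2) ℂ) = 1 := by
  ext x y
  simp only [tensorOp, Matrix.of_apply, Pi.one_apply]
  by_cases h : x = y
  · subst h; simp
  · obtain ⟨q, hq⟩ := Function.ne_iff.mp h
    rw [Matrix.one_apply_ne h]
    exact Finset.prod_eq_zero (Finset.mem_univ q) (Matrix.one_apply_ne hq)

omit [DecidableEq Q] in
theorem tensorOp_conjTranspose (A : Q → Matrix (Fin 2) (Fin 2) ℂ) :
    (tensorOp A)ᴴ = tensorOp fun q => (A q)ᴴ := by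
  ext x y
  simp [tensorOp, Matrix.conjTranspose_apply]

theorem trace_tensorOp (A : Q → Matrix (Fin 2) (Fin 2) ℂ) :
    (tensorOp A).trace = ∏ q, (A q).trace := by
  simp only [tensorOp, Matrix.trace, Matrix.diag_apply, Matrix.of_apply]
  rw [Finset.prod_univ_sum, Fintype.piFinset_univ]

omit [Fintype Q] [DecidableEq Q] in
theorem extendOp_apply (H : QubitOp Q) (x y : Q ⊕ R → Fin 2) :
    extendOp H x y
      = H (fun q => x (.inl q)) (fun q => y (.inl q)) *
        (1 : QubitOp R) (fun r => x (.inr r)) (fun r => y (.inr r)) := rfl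

omit [DecidableEq Q] [DecidableEq R] in
theorem tensorOp_sum (A : Q ⊕ R → Matrix (Fin 2) (Fin 2) ℂ) :
    tensorOp A = Matrix.reindex (Equiv.sumArrowEquivProdArrow Q R (Fin 2)).symm
      (Equiv.sumArrowEquivProdArrow Q R (Fin 2)).symm
      (tensorOp (fun q => A (.inl q)) ⊗ₖ tensorOp fun r => A (.inr r)) := by
  ext x y
  simp only [tensorOp, Matrix.of_apply, Fintype.prod_sum_type]
  rfl

theorem extendOp_mul (H K : QubitOp Q) :
    (extendOp (H * K) : QubitOp (Q ⊕ R)) = extendOp H * extendOp K := by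
  simp only [extendOp, Matrix.reindex_apply, Matrix.submatrix_mul_equiv,
    ← Matrix.mul_kronecker_mul, mul_one]

omit [DecidableEq Q] [Fintype Q] in
theorem extendOp_smul (c : ℂ) (H : QubitOp Q) :
    (extendOp (c • H) : QubitOp (Q ⊕ R)) = c • extendOp H := by
  ext x y; simp [extendOp_apply, mul_assoc]

omit [DecidableEq Q] [Fintype Q] in
theorem extendOp_sum {ι : Type*} (s : Finset ι) (H : ι → QubitOp Q) :
    (extendOp (∑ i ∈ s, H i) : QubitOp (Q ⊕ R)) = ∑ i ∈ s, extendOp (H i) := by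
  ext x y; simp [extendOp_apply, Matrix.sum_apply, Finset.sum_mul]

omit [DecidableEq Q] in
theorem extendOp_tensorOp (A : Q → Matrix (Fin 2) (Fin 2) ℂ) :
    (extendOp (tensorOp A) : QubitOp (Q ⊕ R)) = tensorOp (Sum.elim A 1) := by
  rw [tensorOp_sum]
  simp only [Sum.elim_inl, Sum.elim_inr]
  rw [show (fun r => (1 : R → Matrix (Fin 2) (Fin 2) ℂ) r) = 1 from rfl, tensorOp_one]
  rfl

theorem extendOp_onQubit (A : Matrix (Fin 2) (Fin 2) ℂ) (q : Q) :
    (extendOp (onQubit A q) : QubitOp (Q ⊕ R)) = onQubit A (.inl q) := by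
  rw [onQubit, extendOp_tensorOp, onQubit]
  congr 1
  ext r : 1
  rcases r with r | r
  · by_cases h : r = q
    · subst h; simp
    · simp [h]
  · simp

/-- A traceless factor on any ancilla kills the contribution of the unknown `H`. -/
theorem trace_extendOp_mul_tensorOp (H : QubitOp Q) (A : Q ⊕ R → Matrix (Fin 2) (Fin 2) ℂ) :
    (extendOp H * tensorOp A).trace
      = (H * tensorOp fun q => A (.inl q)).trace * ∏ r, (A (.inr r)).trace := by
  rw [tensorOp_sum, extendOp, Matrix.reindex_apply, Matrix.reindex_apply,
    Matrix.submatrix_mul_equiv, ← Matrix.mul_kronecker_mul, one_mul, ← trace_tensorOp,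
    ← Matrix.trace_kronecker]
  exact Fintype.sum_equiv (Equiv.sumArrowEquivProdArrow Q R (Fin 2)) _ _ fun _ => rfl

theorem tensorOp_conj_extendOp (H : QubitOp Q) (u : Q ⊕ R → Matrix (Fin 2) (Fin 2) ℂ)
    (hu : ∀ r, u (.inr r) ∈ Matrix.unitaryGroup (Fin 2) ℂ) :
    tensorOp u * extendOp H * (tensorOp u)ᴴ
      = extendOp ((tensorOp fun q => u (.inl q)) * H * (tensorOp fun q => u (.inl q))ᴴ) := by
  have h1 : (tensorOp fun r => u (.inr r)) * (tensorOp fun r => u (.inr r))ᴴ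
      = (1 : QubitOp R) := by
    rw [tensorOp_conjTranspose, tensorOp_mul, ← tensorOp_one]
    congr 1
    ext r : 1
    exact Matrix.mem_unitaryGroup_iff.mp (hu r)
  rw [tensorOp_sum u, extendOp, extendOp]
  simp only [Matrix.reindex_apply, Matrix.conjTranspose_submatrix, Matrix.submatrix_mul_equiv,
    Matrix.conjTranspose_kronecker, ← Matrix.mul_kronecker_mul, mul_one, h1]

theorem onQubit_mul_onQubit (A B : Matrix (Fin 2) (Fin 2) ℂ) {p q : Q} (h : p ≠ q) :
    onQubit A p * onQubit B q = tensorOp (update (update 1 p A) q B) := by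
  rw [onQubit, onQubit, tensorOp_mul]
  congr 1
  ext r : 1
  by_cases hq : r = q
  · subst hq; simp [h.symm]
  · by_cases hp : r = p
    · subst hp; simp [h]
    · simp [hp, hq]

theorem tensorOp_conj_onQubit (u : Q → Matrix (Fin 2) (Fin 2) ℂ)
    (hu : ∀ q, u q ∈ Matrix.unitaryGroup (Fin 2) ℂ) (A : Matrix (Fin 2) (Fin 2) ℂ) (q : Q) :
    tensorOp u * onQubit A q * (tensorOp u)ᴴ = onQubit (u q * A * (u q)ᴴ) q := by
  rw [onQubit, tensorOp_conjTranspose, tensorOp_mul, tensorOp_mul, onQubit]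
  congr 1
  ext r : 1
  by_cases h : r = q
  · subst h; simp
  · simp only [Pi.mul_apply, ne_eq, h, not_false_eq_true, update_of_ne, mul_one]
    exact Matrix.mem_unitaryGroup_iff.mp (hu r)

theorem tensorOp_mem_unitary (u : Q → Matrix (Fin 2) (Fin 2) ℂ)
    (hu : ∀ q, u q ∈ Matrix.unitaryGroup (Fin 2) ℂ) :
    (tensorOp u)ᴴ * tensorOp u = 1 := by
  rw [tensorOp_conjTranspose, tensorOp_mul, ← tensorOp_one]
  congr 1
  ext r : 1
  exact Matrix.mem_unitaryGroup_iff'.mp (hu r)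

theorem trace_conj_mul_tensorOp (u P : Q → Matrix (Fin 2) (Fin 2) ℂ) (K : QubitOp Q) :
    (tensorOp u * K * (tensorOp u)ᴴ * tensorOp P).trace
      = (K * tensorOp fun q => (u q)ᴴ * P q * u q).trace := by
  rw [mul_assoc, mul_assoc, Matrix.trace_mul_comm, tensorOp_conjTranspose, mul_assoc,
    tensorOp_mul, tensorOp_mul]
  rfl

theorem trace_onQubit_mul_tensorOp_eq_zero (A : Matrix (Fin 2) (Fin 2) ℂ) {q r : Q}
    (F : Q → Matrix (Fin 2) (Fin 2) ℂ) (hr : r ≠ q) (h : (F r).trace = 0) :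
    (onQubit A q * tensorOp F).trace = 0 := by
  rw [onQubit, tensorOp_mul, trace_tensorOp]
  exact Finset.prod_eq_zero (Finset.mem_univ r) (by simp [hr, h])

theorem trace_onQubit_mul_tensorOp_eq_zero_of_one {A : Matrix (Fin 2) (Fin 2) ℂ} {q : Q}
    (F : Q → Matrix (Fin 2) (Fin 2) ℂ) (hA : A.trace = 0) (h : F q = 1) :
    (onQubit A q * tensorOp F).trace = 0 := by
  rw [onQubit, tensorOp_mul, trace_tensorOp]
  exact Finset.prod_eq_zero (Finset.mem_univ q) (by simp [hA, h])

theorem trace_onQubit_mul_tensorOp (A : Matrix (Fin 2) (Fin 2) ℂ) {q : Q}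
    (F : Q → Matrix (Fin 2) (Fin 2) ℂ) (hF : ∀ r, r ≠ q → F r = 1) :
    (onQubit A q * tensorOp F).trace = 2 ^ (Fintype.card Q - 1) * (A * F q).trace := by
  rw [onQubit, tensorOp_mul, trace_tensorOp, ← Finset.prod_erase_mul _ _ (Finset.mem_univ q),
    Finset.prod_congr rfl (g := fun _ => (2 : ℂ)) fun r hr => ?_]
  · simp [Finset.card_erase_of_mem]
  · have hr := Finset.ne_of_mem_erase hr
    simp [hr, hF r hr]

theorem trace_pair_mul_tensorOp (A B : Matrix (Fin 2) (Fin 2) ℂ) {p q : Q} (hpq : p ≠ q)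
    (F : Q → Matrix (Fin 2) (Fin 2) ℂ) :
    (onQubit A p * onQubit B q * tensorOp F).trace
      = (∏ r ∈ (Finset.univ.erase p).erase q, (F r).trace) *
          ((B * F q).trace * (A * F p).trace) := by
  rw [onQubit_mul_onQubit _ _ hpq, tensorOp_mul, trace_tensorOp,
    ← Finset.prod_erase_mul _ _ (Finset.mem_univ p),
    ← Finset.prod_erase_mul _ _ (Finset.mem_erase.mpr ⟨hpq.symm, Finset.mem_univ q⟩), mul_assoc]
  congr 1
  · refine Finset.prod_congr rfl fun r hr => ?_
    have h1 := Finset.ne_of_mem_erase hr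
    have h2 := Finset.ne_of_mem_erase (Finset.mem_of_mem_erase hr)
    simp [h1, h2]
  · simp [hpq]

end TensorProducts

/-! ### Stoquasticity tests and the Bloch rotation of a single-qubit unitary -/

section Stoquastic

open scoped ComplexOrder

/-- Hermiticity makes the diagonal real, and `z ≤ 0` in the complex order already contains `z.im =
0`. -/
theorem globallyStoquastic_iff {Q : Type*} {M : QubitOp Q} (hM : M.IsHermitian) :
    GloballyStoquastic M ↔ ∀ x y, x ≠ y → M x y ≤ 0 := by
  constructor
  · intro h x y hxy
    exact Complex.nonpos_iff.mpr ⟨h.2 x y hxy, h.1 x y⟩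
  · intro h
    refine ⟨fun x y => ?_, fun x y hxy => (Complex.nonpos_iff.mp (h x y hxy)).1⟩
    by_cases hxy : x = y
    · subst hxy
      have := congrArg Complex.im (hM.apply x x)
      simp only [Complex.star_def, Complex.conj_im] at this
      linarith
    · exact (Complex.nonpos_iff.mp (h x y hxy)).2

theorem GloballyStoquastic.nonpos {Q : Type*} {M : QubitOp Q} (h : GloballyStoquastic M)
    {x y : Q → Fin 2} (hxy : x ≠ y) : M x y ≤ 0 :=
  Complex.nonpos_iff.mpr ⟨h.2 x y hxy, h.1 x y⟩

/-- Tracing a globally stoquastic operator against a product of entrywise nonnegative matrices, one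
of which has zero diagonal, yields a nonpositive number. -/
theorem GloballyStoquastic.trace_mul_tensorOp_nonpos {Q : Type*} [Fintype Q] [DecidableEq Q]
    {M : QubitOp Q} (h : GloballyStoquastic M) (P : Q → Matrix (Fin 2) (Fin 2) ℂ)
    (hP : ∀ q i j, 0 ≤ P q i j) (q : Q) (hq : ∀ i, P q i i = 0) :
    (M * tensorOp P).trace ≤ 0 := by
  simp only [Matrix.trace, Matrix.diag_apply, Matrix.mul_apply]
  refine Finset.sum_nonpos fun x _ => Finset.sum_nonpos fun y _ => ?_
  by_cases hxy : x = y
  · subst hxy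
    rw [tensorOp, Matrix.of_apply, Finset.prod_eq_zero (Finset.mem_univ q) (hq _), mul_zero]
  · exact mul_nonpos_of_nonpos_of_nonneg (h.nonpos hxy) (Finset.prod_nonneg fun r _ => hP r _ _)

/-- The Pauli matrices `X, Y, Z`, indexed by `0, 1, 2`. -/
noncomputable def pauli : Fin 3 → Matrix (Fin 2) (Fin 2) ℂ := ![pauliX, pauliY, pauliZ]

theorem trace_pauli (k : Fin 3) : (pauli k).trace = 0 := by
  fin_cases k <;> simp [pauli, pauliX, pauliY, pauliZ, Matrix.trace]

theorem pauli_isHermitian (k : Fin 3) : (pauli k).IsHermitian := by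
  fin_cases k <;> ext i j <;> fin_cases i <;> fin_cases j <;>
    simp [pauli, pauliX, pauliY, pauliZ, Matrix.conjTranspose_apply]

theorem trace_pauli_mul_pauli (k m : Fin 3) :
    (pauli k * pauli m).trace = if k = m then 2 else 0 := by
  fin_cases k <;> fin_cases m <;>
    simp [pauli, pauliX, pauliY, pauliZ, Matrix.trace, Fin.sum_univ_two] <;> norm_num

theorem eq_sum_pauli_of_isHermitian {A : Matrix (Fin 2) (Fin 2) ℂ} (hA : A.IsHermitian)
    (h0 : A.trace = 0) :
    A = ∑ k, (((pauli k * A).trace.re / 2 : ℝ) : ℂ) • pauli k := by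
  have h00 := congrArg Complex.im (hA.apply 0 0)
  have h01r := congrArg Complex.re (hA.apply 0 1)
  have h01i := congrArg Complex.im (hA.apply 0 1)
  have htr := congrArg Complex.re h0
  have hti := congrArg Complex.im h0
  simp [Matrix.trace, Fin.sum_univ_two] at h00 h01r h01i htr hti
  ext i j
  fin_cases i <;> fin_cases j <;> apply Complex.ext <;>
    simp [Fin.sum_univ_three, pauli, pauliX, pauliY, pauliZ, Matrix.trace, Fin.sum_univ_two,
      Matrix.mul_apply, Matrix.vecHead, Matrix.vecTail] <;> linarith

/-- The matrix of the rotation of the Bloch sphere given by `A ↦ Uᴴ A U`. -/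
noncomputable def bloch (u : Matrix (Fin 2) (Fin 2) ℂ) (m k : Fin 3) : ℝ :=
  (pauli k * (uᴴ * pauli m * u)).trace.re / 2

section Bloch

variable {u v : Matrix (Fin 2) (Fin 2) ℂ}

theorem conj_pauli_eq_sum (hu : u ∈ Matrix.unitaryGroup (Fin 2) ℂ) (m : Fin 3) :
    uᴴ * pauli m * u = ∑ k, (bloch u m k : ℂ) • pauli k := by
  apply eq_sum_pauli_of_isHermitian
  · exact Matrix.isHermitian_conjTranspose_mul_mul _ (pauli_isHermitian m)
  · rw [Matrix.trace_mul_comm, ← mul_assoc, ← Matrix.star_eq_conjTranspose,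
      Matrix.mem_unitaryGroup_iff.mp hu, one_mul, trace_pauli]

theorem trace_pauli_mul_conj_pauli (hu : u ∈ Matrix.unitaryGroup (Fin 2) ℂ) (m k : Fin 3) :
    (pauli k * (uᴴ * pauli m * u)).trace = 2 * bloch u m k := by
  rw [conj_pauli_eq_sum hu]
  simp [Finset.mul_sum, Matrix.trace_sum, trace_pauli_mul_pauli, mul_comm]

/-- Unitary conjugation preserves the trace form, for which the Pauli matrices are orthogonal with
common square norm 2. -/
theorem bloch_orthonormal (hu : u ∈ Matrix.unitaryGroup (Fin 2) ℂ) (m n : Fin 3) :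
    ∑ k, bloch u m k * bloch u n k = if m = n then 1 else 0 := by
  have h : ((uᴴ * pauli m * u) * (uᴴ * pauli n * u)).trace = if m = n then 2 else 0 := by
    rw [← trace_pauli_mul_pauli]
    rw [show (uᴴ * pauli m * u) * (uᴴ * pauli n * u)
      = uᴴ * (pauli m * (u * star u) * pauli n * u) by
        simp only [mul_assoc, Matrix.star_eq_conjTranspose], Matrix.mem_unitaryGroup_iff.mp hu,
      Matrix.trace_mul_comm, mul_one, mul_assoc, ← Matrix.star_eq_conjTranspose,
      Matrix.mem_unitaryGroup_iff.mp hu, mul_one]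
  rw [conj_pauli_eq_sum hu m, Finset.sum_mul, Matrix.trace_sum] at h
  simp only [Matrix.smul_mul, Matrix.trace_smul, trace_pauli_mul_conj_pauli hu, smul_eq_mul] at h
  have h2 : (2 : ℂ) * ((∑ k, bloch u m k * bloch u n k : ℝ) : ℂ) = if m = n then 2 else 0 := by
    rw [← h]; push_cast; rw [Finset.mul_sum]
    exact Finset.sum_congr rfl fun k _ => by ring
  split_ifs at h2 ⊢
  · exact_mod_cast mul_left_cancel₀ two_ne_zero (h2.trans (mul_one 2).symm)
  · exact_mod_cast (mul_eq_zero.mp h2).resolve_left two_ne_zero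

theorem single_diag_eq (i : Fin 2) :
    Matrix.single i i (1 : ℂ) = (2 : ℂ)⁻¹ • (1 + (if i = 0 then 1 else -1 : ℂ) • pauli 2) := by
  fin_cases i <;> ext a b <;> fin_cases a <;> fin_cases b <;>
    simp [pauli, pauliZ] <;> norm_num

theorem single_offDiag_eq (i : Fin 2) :
    Matrix.single i (1 - i) (1 : ℂ)
      = (2 : ℂ)⁻¹ • (pauli 0 + ((if i = 0 then 1 else -1 : ℂ) * Complex.I) • pauli 1) := by
  fin_cases i <;> ext a b <;> fin_cases a <;> fin_cases b <;>
    simp [pauli, pauliX, pauliY] <;> norm_num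

/-- The identity part of the projector drops out because Pauli matrices are traceless; only the `Z`
part, with its sign, remains. -/
theorem trace_conj_single_diag (hu : u ∈ Matrix.unitaryGroup (Fin 2) ℂ) (i : Fin 2) (k : Fin 3) :
    (pauli k * (uᴴ * Matrix.single i i 1 * u)).trace
      = (if i = 0 then 1 else -1 : ℂ) * bloch u 2 k := by
  have h := trace_pauli_mul_conj_pauli hu 2 k
  have h1 : uᴴ * u = 1 := Matrix.mem_unitaryGroup_iff'.mp hu
  simp only [single_diag_eq, Matrix.mul_smul, Matrix.smul_mul, Matrix.mul_add, Matrix.add_mul,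
    Matrix.trace_add, Matrix.trace_smul, h, mul_one, h1, trace_pauli, smul_eq_mul]
  ring

theorem trace_conj_single_offDiag (hu : u ∈ Matrix.unitaryGroup (Fin 2) ℂ) (i : Fin 2)
    (k : Fin 3) :
    (pauli k * (uᴴ * Matrix.single i (1 - i) 1 * u)).trace
      = bloch u 0 k + (if i = 0 then 1 else -1 : ℂ) * Complex.I * bloch u 1 k := by
  have h := trace_pauli_mul_conj_pauli hu 0 k
  have h' := trace_pauli_mul_conj_pauli hu 1 k
  simp only [single_offDiag_eq, Matrix.mul_smul, Matrix.smul_mul, Matrix.mul_add, Matrix.add_mul,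
    Matrix.trace_add, Matrix.trace_smul, h, h', smul_eq_mul]
  ring

/-- The coupling matrix `O_u diag(α) O_vᵀ` of the rotated interaction `∑ₖ αₖ σₖ ⊗ σₖ`. -/
noncomputable def rotatedCoupling (α : Fin 3 → ℝ) (u v : Matrix (Fin 2) (Fin 2) ℂ)
    (m n : Fin 3) : ℝ :=
  ∑ k, α k * bloch u m k * bloch v n k

/-- With a projector on the first qubit, both signs of `β₂₀ + i β₂₁` must be nonpositive, so both
entries vanish. With off-diagonal units on both, the tests read `β₀₀ ∓ β₁₁ + i (β₀₁ ± β₁₀) ≤ 0`, up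
to the overall sign of the imaginary part. -/
theorem rotatedCoupling_of_nonpos {α : Fin 3 → ℝ} (hu : u ∈ Matrix.unitaryGroup (Fin 2) ℂ)
    (hv : v ∈ Matrix.unitaryGroup (Fin 2) ℂ)
    (h : ∀ i j a : Fin 2,
      ∑ k, (α k : ℂ) * ((pauli k * (uᴴ * Matrix.single i j 1 * u)).trace *
        (pauli k * (vᴴ * Matrix.single a (1 - a) 1 * v)).trace) ≤ 0) :
    rotatedCoupling α u v 2 0 = 0 ∧ rotatedCoupling α u v 2 1 = 0 ∧
      rotatedCoupling α u v 0 1 = 0 ∧ rotatedCoupling α u v 1 0 = 0 ∧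
      rotatedCoupling α u v 0 0 ≤ -|rotatedCoupling α u v 1 1| := by
  have h1 := Complex.nonpos_iff.mp (h 0 0 0)
  have h2 := Complex.nonpos_iff.mp (h 1 1 0)
  have h3 := Complex.nonpos_iff.mp (h 0 (1 - 0) 0)
  have h4 := Complex.nonpos_iff.mp (h 0 (1 - 0) 1)
  simp only [trace_conj_single_diag hu, trace_conj_single_offDiag hu,
    trace_conj_single_offDiag hv, Fin.sum_univ_three] at h1 h2 h3 h4
  simp at h1 h2 h3 h4
  simp only [rotatedCoupling, Fin.sum_univ_three]
  refine ⟨by linarith, by linarith, by linarith, by linarith, ?_⟩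
  rw [le_neg, abs_le]
  constructor <;> linarith

end Bloch

end Stoquastic

/-! ### Two-qubit Pauli interactions -/

section Heisenberg

variable {Q R : Type*} [Fintype Q] [DecidableEq Q] [Fintype R] [DecidableEq R]

/-- The interaction `∑ₖ αₖ σₖ ⊗ σₖ` of the qubits `p` and `q`. -/
noncomputable def heisenberg (α : Fin 3 → ℝ) (p q : Q) : QubitOp Q :=
  ∑ k, (α k : ℂ) • (onQubit (pauli k) p * onQubit (pauli k) q)

theorem onQubit_commute (A B : Matrix (Fin 2) (Fin 2) ℂ) {p q : Q} (h : p ≠ q) :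
    onQubit A p * onQubit B q = onQubit B q * onQubit A p := by
  rw [onQubit_mul_onQubit _ _ h, onQubit_mul_onQubit _ _ h.symm, Function.update_comm h]

theorem heisenberg_comm (α : Fin 3 → ℝ) {p q : Q} (h : p ≠ q) :
    heisenberg α p q = heisenberg α q p :=
  Finset.sum_congr rfl fun k _ => by rw [onQubit_commute _ _ h]

theorem extendOp_heisenberg (α : Fin 3 → ℝ) (p q : Q) :
    (extendOp (heisenberg α p q) : QubitOp (Q ⊕ R)) = heisenberg α (.inl p) (.inl q) := by
  simp only [heisenberg, extendOp_sum, extendOp_smul, extendOp_mul, extendOp_onQubit]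

theorem trace_heisenberg_mul_tensorOp (α : Fin 3 → ℝ) {p q : Q} (hpq : p ≠ q)
    (F : Q → Matrix (Fin 2) (Fin 2) ℂ) :
    (heisenberg α p q * tensorOp F).trace
      = (∏ r ∈ (Finset.univ.erase p).erase q, (F r).trace) *
        ∑ k, (α k : ℂ) * ((pauli k * F p).trace * (pauli k * F q).trace) := by
  simp only [heisenberg, Finset.sum_mul, Matrix.smul_mul, Matrix.trace_sum, Matrix.trace_smul,
    trace_pair_mul_tensorOp _ _ hpq, Finset.mul_sum, smul_eq_mul]
  exact Finset.sum_congr rfl fun k _ => by ring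

theorem trace_heisenberg_mul_tensorOp_eq_zero (α : Fin 3 → ℝ) {p q r : Q} (hpq : p ≠ q)
    (hp : r ≠ p) (hq : r ≠ q) {F : Q → Matrix (Fin 2) (Fin 2) ℂ} (hF : (F r).trace = 0) :
    (heisenberg α p q * tensorOp F).trace = 0 := by
  rw [trace_heisenberg_mul_tensorOp α hpq, Finset.prod_eq_zero (i := r) (by simp [hp, hq]) hF,
    zero_mul]

theorem trace_heisenberg_mul_tensorOp_eq_zero_of_left (α : Fin 3 → ℝ) {p q : Q} (hpq : p ≠ q)
    {F : Q → Matrix (Fin 2) (Fin 2) ℂ} (hF : F p = 1) :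
    (heisenberg α p q * tensorOp F).trace = 0 := by
  simp [trace_heisenberg_mul_tensorOp α hpq, hF, trace_pauli]

theorem trace_heisenberg_mul_tensorOp_eq_zero_of_right (α : Fin 3 → ℝ) {p q : Q} (hpq : p ≠ q)
    {F : Q → Matrix (Fin 2) (Fin 2) ℂ} (hF : F q = 1) :
    (heisenberg α p q * tensorOp F).trace = 0 := by
  simp [trace_heisenberg_mul_tensorOp α hpq, hF, trace_pauli]

end Heisenberg

/-! ### Rigidity of the Bloch rotations along the gadget chain -/

section Rotations

/-- The matrix `β` is orthogonal. Its last row leaves only `β₂₂ = ±1`, so its last column is zero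
above, hence `β` is diagonal with entries `±1`; the inequality makes `β₀₀ = 1`. -/
theorem aligned_of_rotatedCoupling {O P : Matrix (Fin 3) (Fin 3) ℝ} (hO : O * Oᵀ = 1)
    (hP : P * Pᵀ = 1) {β : Matrix (Fin 3) (Fin 3) ℝ} (hβ : β = O * Pᵀ) (h20 : β 2 0 = 0)
    (h21 : β 2 1 = 0) (h01 : β 0 1 = 0) (h10 : β 1 0 = 0) (h : |β 1 1| ≤ β 0 0) :
    O 0 = P 0 ∧ (∃ s : ℝ, s ^ 2 = 1 ∧ O 1 = s • P 1) ∧ ∃ s : ℝ, s ^ 2 = 1 ∧ O 2 = s • P 2 := by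
  have hP' : Pᵀ * P = 1 := mul_eq_one_comm.mp hP
  have h1 : β * βᵀ = 1 := by
    rw [hβ, Matrix.transpose_mul, Matrix.transpose_transpose, mul_assoc, ← mul_assoc Pᵀ, hP',
      one_mul, hO]
  have h2 : βᵀ * β = 1 := mul_eq_one_comm.mp h1
  have hOβ : O = β * P := by rw [hβ, mul_assoc, hP', mul_one]
  have e22 := congrFun₂ h1 2 2
  have f22 := congrFun₂ h2 2 2
  have e00 := congrFun₂ h1 0 0
  have e11 := congrFun₂ h1 1 1
  simp [Matrix.mul_apply, Fin.sum_univ_three, h20, h21, h01, h10] at e22 f22 e00 e11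
  have h02 : β 0 2 = 0 := by nlinarith [sq_nonneg (β 0 2), sq_nonneg (β 1 2)]
  have h12 : β 1 2 = 0 := by nlinarith [sq_nonneg (β 0 2), sq_nonneg (β 1 2)]
  rw [h02] at e00
  rw [h12] at e11
  have h00 : β 0 0 = 1 := by nlinarith [abs_nonneg (β 1 1)]
  refine ⟨?_, ⟨β 1 1, by linarith, ?_⟩, ⟨β 2 2, by linarith, ?_⟩⟩ <;> ext k <;>
    rw [hOβ] <;> simp [Matrix.mul_apply, Fin.sum_univ_three, h20, h21, h01, h10, h02, h12, h00]

theorem eq_one_of_mul_self_eq_one {x : ℝ} (h0 : 0 ≤ x) (h : x * x = 1) : x = 1 :=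
  (mul_self_eq_one_iff.mp h).resolve_right fun h => by linarith

theorem eq_neg_of_sq_eq {x a : ℝ} (h0 : x < 0) (ha : 0 < a) (h : x ^ 2 = a ^ 2) : x = -a :=
  (sq_eq_sq_iff_eq_or_eq_neg.mp h).resolve_left fun h => by linarith

/-- The relation `A D Bᵀ = diag r` is a singular value decomposition with distinct singular values
3, 1, 2, so rows of `B` lie on coordinate axes. The field at `C` treats `X` and `Z` alike, so the
second row must be along `Y`, leaving `X` or `Z` for the first. -/
theorem rows_of_gadget {U A B C : Matrix (Fin 3) (Fin 3) ℝ} (hU : U * Uᵀ = 1) (hA : A * Aᵀ = 1)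
    (hB : B * Bᵀ = 1) (hUA0 : U 0 = A 0) (hUA2 : ∃ s : ℝ, s ^ 2 = 1 ∧ U 2 = s • A 2)
    (hCB0 : C 0 = B 0) (hCB1 : ∃ s : ℝ, s ^ 2 = 1 ∧ C 1 = s • B 1)
    (hC0 : 0 ≤ C 0 0 + C 0 2) (hC1 : C 1 0 + C 1 2 = 0)
    {r : Fin 3 → ℝ} (hr : A * Matrix.diagonal ![-3, -1, -2] * Bᵀ = Matrix.diagonal r)
    (hr0 : r 0 ≤ -|r 1|) :
    (U 0 = ![1, 0, 0] ∧ ∃ s : ℝ, s ^ 2 = 1 ∧ U 2 = ![0, 0, s]) ∨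
      (U 0 = ![0, 0, 1] ∧ ∃ s : ℝ, s ^ 2 = 1 ∧ U 2 = ![s, 0, 0]) := by
  have hA' : Aᵀ * A = 1 := mul_eq_one_comm.mp hA
  have hB' : Bᵀ * B = 1 := mul_eq_one_comm.mp hB
  have hr1 : A * Matrix.diagonal ![-3, -1, -2] = Matrix.diagonal r * B := by
    rw [← hr, mul_assoc, hB', mul_one]
  have hr2 : B * Matrix.diagonal ![-3, -1, -2] = Matrix.diagonal r * A := by
    have := congrArg Matrix.transpose hr
    simp only [Matrix.transpose_mul, Matrix.diagonal_transpose, Matrix.transpose_transpose,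
      ← mul_assoc] at this
    rw [← this, mul_assoc, hA', mul_one]
  have e1 : ∀ m k, A m k * (![-3, -1, -2] : Fin 3 → ℝ) k = r m * B m k := fun m k => by
    simpa only [Matrix.mul_diagonal, Matrix.diagonal_mul] using congrFun₂ hr1 m k
  have e2 : ∀ m k, B m k * (![-3, -1, -2] : Fin 3 → ℝ) k = r m * A m k := fun m k => by
    simpa only [Matrix.mul_diagonal, Matrix.diagonal_mul] using congrFun₂ hr2 m k
  have oU : ∀ m n, U m 0 * U n 0 + U m 1 * U n 1 + U m 2 * U n 2 = if m = n then 1 else 0 :=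
    fun m n => by
      simpa [Matrix.mul_apply, Fin.sum_univ_three, Matrix.one_apply] using congrFun₂ hU m n
  have oA : ∀ m n, A m 0 * A n 0 + A m 1 * A n 1 + A m 2 * A n 2 = if m = n then 1 else 0 :=
    fun m n => by
      simpa [Matrix.mul_apply, Fin.sum_univ_three, Matrix.one_apply] using congrFun₂ hA m n
  have oB : ∀ m n, B m 0 * B n 0 + B m 1 * B n 1 + B m 2 * B n 2 = if m = n then 1 else 0 :=
    fun m n => by
      simpa [Matrix.mul_apply, Fin.sum_univ_three, Matrix.one_apply] using congrFun₂ hB m n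
  -- Applying `D` twice gives `B D² = diag(r)² B`: the entry `(m, k)` of `B` vanishes unless `r m ^
  -- 2` is the square of the `k`-th entry of `D`.
  have sq : ∀ m k, B m k * ((![-3, -1, -2] : Fin 3 → ℝ) k ^ 2 - r m ^ 2) = 0 := fun m k => by
    linear_combination (![-3, -1, -2] : Fin 3 → ℝ) k * e2 m k + r m * e1 m k
  have hB1 : B 1 0 + B 1 2 = 0 := by
    obtain ⟨s, hs, h⟩ := hCB1
    have hs0 : s ≠ 0 := by rintro rfl; norm_num at hs
    rw [h] at hC1
    simp only [Pi.smul_apply, smul_eq_mul, ← mul_add] at hC1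
    exact (mul_eq_zero.mp hC1).resolve_left hs0
  -- If both entries were nonzero, `r 1 ^ 2` would be both 9 and 4.
  have hB10 : B 1 0 = 0 := by
    have s0 := sq 1 0
    have s2 := sq 1 2
    simp at s0 s2
    have : B 1 2 = - B 1 0 := by linarith
    rcases s0 with h | h
    · exact h
    · rcases s2 with h' | h'
      · linarith
      · exfalso; linarith
  have hB12 : B 1 2 = 0 := by linarith
  have hB11 : B 1 1 ^ 2 = 1 := by
    have := oB 1 1
    simp [hB10, hB12] at this
    nlinarith
  have hB01 : B 0 1 = 0 := by
    have h := oB 0 1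
    simp [hB10, hB12] at h
    rcases h with h | h
    · exact h
    · rw [h] at hB11; norm_num at hB11
  have hr1' : r 1 ^ 2 = 1 := by
    have := sq 1 1
    simp at this
    rcases this with h | h
    · rw [h] at hB11; norm_num at hB11
    · linarith
  have hA10 : A 1 0 = 0 := by have := e1 1 0; simp [hB10] at this; exact this
  have hA12 : A 1 2 = 0 := by have := e1 1 2; simp [hB12] at this; exact this
  have hA11 : A 1 1 ≠ 0 := by
    intro h
    have := oA 1 1
    simp [hA10, hA12, h] at this
  have hA21 : A 2 1 = 0 := by
    have h := oA 2 1
    simp [hA10, hA12, hA11] at h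
    exact h
  -- Since `r 1 ^ 2 = 1`, the bound `r 0 ≤ -|r 1|` is strict at zero. The negative sign matters: it
  -- gives the first rows of `A` and `B` the same sign.
  have hr0n : r 0 < 0 := by
    rcases lt_or_eq_of_le (hr0.trans (neg_nonpos.mpr (abs_nonneg _))) with h | h
    · exact h
    · have : |r 1| = 0 := le_antisymm (by linarith) (abs_nonneg _)
      rw [abs_eq_zero.mp this] at hr1'
      norm_num at hr1'
  have hU21 : U 2 1 = 0 := by
    obtain ⟨s, -, h⟩ := hUA2
    simp [h, hA21]
  have hA01 : A 0 1 = 0 := by have := e1 0 1; simp [hB01] at this; exact this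
  have n0 := oB 0 0
  have nU := oU 2 2
  have dU := oU 2 0
  simp [hB01, hU21] at n0 nU dU
  rw [hCB0] at hC0
  have t0 := sq 0 0
  have t2 := sq 0 2
  have a0 := e1 0 0
  have a2 := e1 0 2
  simp at t0 t2 a0 a2
  -- Either the first row of `B` has no `Z` component and is along `X`, or `r 0 ^ 2 = 4` and it is
  -- along `Z`.
  rcases t2 with h2 | h2
  · left
    have hB00 : B 0 0 = 1 := by
      rw [h2] at n0 hC0
      exact eq_one_of_mul_self_eq_one (by linarith) (by linarith)
    have hr3 : r 0 = -3 := by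
      rcases t0 with h | h
      · linarith
      · exact eq_neg_of_sq_eq hr0n (by norm_num) (by linarith)
    have hA00 : A 0 0 = 1 := by rw [hr3, hB00] at a0; linarith
    have hA02 : A 0 2 = 0 := by rw [h2] at a2; linarith
    have hU0 : U 0 = ![1, 0, 0] := by
      rw [hUA0]; ext k; fin_cases k <;> simp [hA00, hA01, hA02]
    have hU20 : U 2 0 = 0 := by simp [hU0] at dU; exact dU
    refine ⟨hU0, U 2 2, by rw [hU20] at nU; linarith, ?_⟩
    ext k; fin_cases k <;> simp [hU20, hU21]
  · right
    have hr3 : r 0 = -2 := eq_neg_of_sq_eq hr0n (by norm_num) (by linarith)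
    have h0 : B 0 0 = 0 := by
      rcases t0 with h | h
      · exact h
      · rw [hr3] at h; norm_num at h
    have hB02 : B 0 2 = 1 := by
      rw [h0] at n0 hC0
      exact eq_one_of_mul_self_eq_one (by linarith) (by linarith)
    have hA02 : A 0 2 = 1 := by rw [hr3, hB02] at a2; linarith
    have hA00 : A 0 0 = 0 := by rw [h0] at a0; linarith
    have hU0 : U 0 = ![0, 0, 1] := by
      rw [hUA0]; ext k; fin_cases k <;> simp [hA00, hA01, hA02]
    have hU22 : U 2 2 = 0 := by simp [hU0] at dU; exact dU
    refine ⟨hU0, U 2 0, by rw [hU22] at nU; linarith, ?_⟩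
    ext k; fin_cases k <;> simp [hU22, hU21]

end Rotations

/-! ### The Hadamard matrix and unitaries determined up to a bit flip -/

section Hadamard

theorem hadamardW_isHermitian : hadamardWᴴ = hadamardW := by
  ext i j
  fin_cases i <;> fin_cases j <;> simp [hadamardW, Matrix.conjTranspose_apply]

theorem hadamardW_mul_self : hadamardW * hadamardW = 1 := by
  have h : ((Real.sqrt 2 : ℝ) : ℂ)⁻¹ * ((Real.sqrt 2 : ℝ) : ℂ)⁻¹ = 2⁻¹ := by
    rw [← mul_inv, ← Complex.ofReal_mul, Real.mul_self_sqrt (by norm_num)]; norm_num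
  rw [hadamardW, smul_mul_smul_comm, h]
  ext i j
  fin_cases i <;> fin_cases j <;> simp <;> norm_num

theorem hadamardW_pow_isHermitian (x : Fin 2) :
    (hadamardW ^ (x : ℕ))ᴴ = hadamardW ^ (x : ℕ) := by
  rw [Matrix.conjTranspose_pow, hadamardW_isHermitian]

theorem hadamardW_pow_mem_unitaryGroup (x : Fin 2) :
    hadamardW ^ (x : ℕ) ∈ Matrix.unitaryGroup (Fin 2) ℂ := by
  rw [Matrix.mem_unitaryGroup_iff, Matrix.star_eq_conjTranspose, hadamardW_pow_isHermitian,
    ← pow_add, ← two_mul, pow_mul, pow_two, hadamardW_mul_self, one_pow]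

theorem hadamardW_conj_pauliX : hadamardW * pauliX * hadamardW = pauliZ := by
  have h : ((Real.sqrt 2 : ℝ) : ℂ)⁻¹ * ((Real.sqrt 2 : ℝ) : ℂ)⁻¹ = 2⁻¹ := by
    rw [← mul_inv, ← Complex.ofReal_mul, Real.mul_self_sqrt (by norm_num)]; norm_num
  rw [hadamardW, Matrix.smul_mul, smul_mul_smul_comm, h]
  ext i j
  fin_cases i <;> fin_cases j <;> simp [pauliX, pauliZ] <;> norm_num

theorem hadamardW_conj_pauliZ : hadamardW * pauliZ * hadamardW = pauliX := by
  rw [← hadamardW_conj_pauliX]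
  simp only [mul_assoc, hadamardW_mul_self, mul_one]
  rw [← mul_assoc, hadamardW_mul_self, one_mul]

theorem hadamardW_conj_pauliY : hadamardW * pauliY * hadamardW = -pauliY := by
  have h : ((Real.sqrt 2 : ℝ) : ℂ)⁻¹ * ((Real.sqrt 2 : ℝ) : ℂ)⁻¹ = 2⁻¹ := by
    rw [← mul_inv, ← Complex.ofReal_mul, Real.mul_self_sqrt (by norm_num)]; norm_num
  rw [hadamardW, Matrix.smul_mul, smul_mul_smul_comm, h]
  ext i j
  fin_cases i <;> fin_cases j <;> simp [pauliY] <;> ring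

/-- Conjugation is multiplicative, and the matrix units are generated by `X` and the projectors `(1
± Z)/2`. The sign `s = -1` exchanges the two projectors, which is the bit flip. -/
theorem exists_perm_conj_single {u w : Matrix (Fin 2) (Fin 2) ℂ}
    (hu : u ∈ Matrix.unitaryGroup (Fin 2) ℂ) (hw : w ∈ Matrix.unitaryGroup (Fin 2) ℂ) {s : ℂ}
    (hs : s = 1 ∨ s = -1) (hX : uᴴ * pauli 0 * u = wᴴ * pauli 0 * w)
    (hZ : uᴴ * pauli 2 * u = s • (wᴴ * pauli 2 * w)) :
    ∃ π : Equiv.Perm (Fin 2), ∀ i j,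
      uᴴ * Matrix.single i j 1 * u = wᴴ * Matrix.single (π i) (π j) 1 * w := by
  have hu1 : uᴴ * u = 1 := Matrix.mem_unitaryGroup_iff'.mp hu
  have hu2 : u * uᴴ = 1 := Matrix.mem_unitaryGroup_iff.mp hu
  have hw1 : wᴴ * w = 1 := Matrix.mem_unitaryGroup_iff'.mp hw
  have hw2 : w * wᴴ = 1 := Matrix.mem_unitaryGroup_iff.mp hw
  have off : ∀ i : Fin 2, Matrix.single i (1 - i) (1 : ℂ) = Matrix.single i i 1 * pauli 0 := by
    intro i
    fin_cases i <;> ext a b <;> fin_cases a <;> fin_cases b <;> simp [pauli, pauliX]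
  have mulc : ∀ {v : Matrix (Fin 2) (Fin 2) ℂ}, v * vᴴ = 1 → ∀ A B : Matrix (Fin 2) (Fin 2) ℂ,
      vᴴ * (A * B) * v = (vᴴ * A * v) * (vᴴ * B * v) := by
    intro v hv A B
    calc vᴴ * (A * B) * v = vᴴ * A * 1 * B * v := by simp only [mul_assoc, mul_one]
      _ = _ := by rw [← hv]; simp only [mul_assoc]
  have diag : ∃ π : Equiv.Perm (Fin 2), (∀ i, π (1 - i) = 1 - π i) ∧ ∀ i,
      uᴴ * Matrix.single i i 1 * u = wᴴ * Matrix.single (π i) (π i) 1 * w := by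
    rcases hs with rfl | rfl
    · refine ⟨1, fun i => rfl, fun i => ?_⟩
      simp only [Equiv.Perm.one_apply, single_diag_eq, Matrix.mul_smul, Matrix.smul_mul,
        Matrix.mul_add, Matrix.add_mul, mul_one, hu1, hw1, hZ, one_smul]
    · refine ⟨Equiv.swap 0 1, by decide, fun i => ?_⟩
      simp only [single_diag_eq, Matrix.mul_smul, Matrix.smul_mul,
        Matrix.mul_add, Matrix.add_mul, mul_one, hu1, hw1, hZ, smul_smul]
      fin_cases i <;> simp
  obtain ⟨π, hπ, hd⟩ := diag
  refine ⟨π, fun i j => ?_⟩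
  by_cases hij : j = i
  · rw [hij]; exact hd i
  · have hj : j = 1 - i := by omega
    rw [hj, hπ, off, off, mulc hu2, mulc hw2, hd, hX]

end Hadamard

/-! ### Isolating single couplings of the first gadget -/

section Isolation

open Function
open scoped ComplexOrder

variable {Q : Type*} [Fintype Q] [DecidableEq Q]

/-- The only part of `K` seen by product operators acting on `p` and `q` alone, tracelessly on `q`,
is the interaction `∑ₖ αₖ σₖ ⊗ σₖ` of `p` and `q`. -/
def IsolatesCoupling (K : QubitOp Q) (α : Fin 3 → ℝ) (p q : Q) : Prop :=
  ∀ F : Q → Matrix (Fin 2) (Fin 2) ℂ, (∀ r, r ≠ p → r ≠ q → F r = 1) → (F q).trace = 0 →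
    (K * tensorOp F).trace = (heisenberg α p q * tensorOp F).trace

theorem trace_conj_of_mem_unitaryGroup {u : Matrix (Fin 2) (Fin 2) ℂ}
    (hu : u ∈ Matrix.unitaryGroup (Fin 2) ℂ) (A : Matrix (Fin 2) (Fin 2) ℂ) :
    (uᴴ * A * u).trace = A.trace := by
  rw [Matrix.trace_mul_comm, ← mul_assoc, ← Matrix.star_eq_conjTranspose,
    Matrix.mem_unitaryGroup_iff.mp hu, one_mul]

theorem trace_single_offDiag (a : Fin 2) : (Matrix.single a (1 - a) (1 : ℂ)).trace = 0 := by
  fin_cases a <;> simp [Matrix.trace]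

theorem single_nonneg (i j a b : Fin 2) : (0 : ℂ) ≤ Matrix.single i j 1 a b := by
  rw [Matrix.single_apply]
  split_ifs <;> norm_num

theorem one_apply_nonneg (a b : Fin 2) : (0 : ℂ) ≤ (1 : Matrix (Fin 2) (Fin 2) ℂ) a b := by
  rw [Matrix.one_apply]
  split_ifs <;> norm_num

theorem single_offDiag_apply_self (a i : Fin 2) : Matrix.single a (1 - a) (1 : ℂ) i i = 0 := by
  fin_cases a <;> fin_cases i <;> simp

theorem conj_one_of_mem_unitaryGroup {u : Matrix (Fin 2) (Fin 2) ℂ}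
    (hu : u ∈ Matrix.unitaryGroup (Fin 2) ℂ) : uᴴ * 1 * u = 1 := by
  rw [mul_one]; exact Matrix.mem_unitaryGroup_iff'.mp hu

theorem IsolatesCoupling.rotatedCoupling_apply {K : QubitOp Q} {α : Fin 3 → ℝ} {p q : Q}
    (h : IsolatesCoupling K α p q) (hpq : p ≠ q) {u : Q → Matrix (Fin 2) (Fin 2) ℂ}
    (hu : ∀ q, u q ∈ Matrix.unitaryGroup (Fin 2) ℂ)
    (hs : GloballyStoquastic (tensorOp u * K * (tensorOp u)ᴴ)) :
    rotatedCoupling α (u p) (u q) 2 0 = 0 ∧ rotatedCoupling α (u p) (u q) 2 1 = 0 ∧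
      rotatedCoupling α (u p) (u q) 0 1 = 0 ∧ rotatedCoupling α (u p) (u q) 1 0 = 0 ∧
      rotatedCoupling α (u p) (u q) 0 0 ≤ -|rotatedCoupling α (u p) (u q) 1 1| := by
  refine rotatedCoupling_of_nonpos (hu p) (hu q) fun i j a => ?_
  have key := hs.trace_mul_tensorOp_nonpos
    (update (update 1 p (Matrix.single i j 1)) q (Matrix.single a (1 - a) 1))
    (fun r b c => by
      by_cases hq : r = q
      · subst hq; simpa using single_nonneg _ _ _ _
      · by_cases hp : r = p
        · subst hp; simpa [hq] using single_nonneg _ _ _ _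
        · simpa [hq, hp] using one_apply_nonneg _ _)
    q (fun b => by simpa using single_offDiag_apply_self a b)
  rw [trace_conj_mul_tensorOp, h _ (fun r hp hq => by
      simpa [hp, hq] using conj_one_of_mem_unitaryGroup (hu r)) (by
      simp [trace_conj_of_mem_unitaryGroup (hu q), trace_single_offDiag]),
    trace_heisenberg_mul_tensorOp _ hpq,
    Finset.prod_congr rfl (g := fun _ => (2 : ℂ)) fun r hr => ?_] at key
  · simp only [update_self, update_of_ne hpq, Finset.prod_const] at key
    refine le_of_mul_le_mul_left (key.trans (mul_zero _).ge) (pow_pos ?_ _)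
    norm_num
  · have h1 := Finset.ne_of_mem_erase hr
    have h2 := Finset.ne_of_mem_erase (Finset.mem_of_mem_erase hr)
    rw [update_of_ne h1, update_of_ne h2, Pi.one_apply, conj_one_of_mem_unitaryGroup (hu r)]
    simp

/-- The summand of `gadgetOne` belonging to the qubit `u`. -/
noncomputable def gadgetBlock (u : Q) : QubitOp (Q ⊕ Q × Fin 3) :=
  -(onQubit (pauli 0) (ancC u) + onQubit (pauli 2) (ancC u))
    + heisenberg ![-1, -1, -1] (orig u) (ancA u) + heisenberg ![-3, -1, -2] (ancA u) (ancB u)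
    + heisenberg ![-1, -1, -1] (ancB u) (ancC u)

theorem gadgetOne_eq_sum : gadgetOne Q = ∑ u, gadgetBlock u := by
  refine Finset.sum_congr rfl fun u _ => ?_
  simp only [gadgetBlock, heisenberg, Fin.sum_univ_three, pauli]
  simp
  abel

theorem gadgetTwo_eq_sum (n l : ℕ) : gadgetTwo n l =
    ∑ j : Fin l, heisenberg ![-1, 0, 1] (.inl (Fin.natAdd n j)) (.inr j) := by
  refine Finset.sum_congr rfl fun u _ => ?_
  simp only [heisenberg, Fin.sum_univ_three, pauli]
  simp

theorem trace_gadgetBlock (u : Q) (F : Q ⊕ Q × Fin 3 → Matrix (Fin 2) (Fin 2) ℂ) :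
    (gadgetBlock u * tensorOp F).trace
      = -((onQubit (pauli 0) (ancC u) * tensorOp F).trace
          + (onQubit (pauli 2) (ancC u) * tensorOp F).trace)
        + (heisenberg ![-1, -1, -1] (orig u) (ancA u) * tensorOp F).trace
        + (heisenberg ![-3, -1, -2] (ancA u) (ancB u) * tensorOp F).trace
        + (heisenberg ![-1, -1, -1] (ancB u) (ancC u) * tensorOp F).trace := by
  simp only [gadgetBlock, Matrix.add_mul, Matrix.neg_mul, Matrix.trace_add, Matrix.trace_neg]

omit [Fintype Q] [DecidableEq Q] in
theorem orig_ne_ancA (u : Q) : orig u ≠ ancA u := by simp [orig, ancA]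

omit [Fintype Q] [DecidableEq Q] in
theorem ancA_ne_ancB (u : Q) : ancA u ≠ ancB u := by simp [ancA, ancB]

omit [Fintype Q] [DecidableEq Q] in
theorem ancB_ne_ancC (u : Q) : ancB u ≠ ancC u := by simp [ancB, ancC]

theorem trace_gadgetBlock_eq_zero_of_ne {u v : Q} (huv : u ≠ v) (i : Fin 3)
    {F : Q ⊕ Q × Fin 3 → Matrix (Fin 2) (Fin 2) ℂ} (hF : (F (.inr (v, i))).trace = 0) :
    (gadgetBlock u * tensorOp F).trace = 0 := by
  have hA : Sum.inr (v, i) ≠ ancA u := by simp [ancA, huv.symm]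
  have hB : Sum.inr (v, i) ≠ ancB u := by simp [ancB, huv.symm]
  have hC : Sum.inr (v, i) ≠ ancC u := by simp [ancC, huv.symm]
  have hO : Sum.inr (v, i) ≠ orig u := by simp [orig]
  rw [trace_gadgetBlock, trace_onQubit_mul_tensorOp_eq_zero _ _ hC hF,
    trace_onQubit_mul_tensorOp_eq_zero _ _ hC hF,
    trace_heisenberg_mul_tensorOp_eq_zero _ (orig_ne_ancA u) hO hA hF,
    trace_heisenberg_mul_tensorOp_eq_zero _ (ancA_ne_ancB u) hA hB hF,
    trace_heisenberg_mul_tensorOp_eq_zero _ (ancB_ne_ancC u) hB hC hF]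
  simp

theorem trace_gadgetBlock_eq_zero_of_one {u : Q}
    {F : Q ⊕ Q × Fin 3 → Matrix (Fin 2) (Fin 2) ℂ} (hF : ∀ i, F (.inr (u, i)) = 1) :
    (gadgetBlock u * tensorOp F).trace = 0 := by
  have hA : F (ancA u) = 1 := hF 0
  have hB : F (ancB u) = 1 := hF 1
  have hC : F (ancC u) = 1 := hF 2
  rw [trace_gadgetBlock, trace_onQubit_mul_tensorOp_eq_zero_of_one _ (trace_pauli 0) hC,
    trace_onQubit_mul_tensorOp_eq_zero_of_one _ (trace_pauli 2) hC,
    trace_heisenberg_mul_tensorOp_eq_zero_of_right _ (orig_ne_ancA u) hA,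
    trace_heisenberg_mul_tensorOp_eq_zero_of_right _ (ancA_ne_ancB u) hB,
    trace_heisenberg_mul_tensorOp_eq_zero_of_right _ (ancB_ne_ancC u) hC]
  simp

/-- Operators that are traceless on an ancilla of `v` see only the gadget of `v`. -/
theorem trace_extendOp_add_gadgetOne (K : QubitOp Q) (v : Q) (i : Fin 3)
    {F : Q ⊕ Q × Fin 3 → Matrix (Fin 2) (Fin 2) ℂ} (hF : (F (.inr (v, i))).trace = 0) :
    ((extendOp K + gadgetOne Q) * tensorOp F).trace = (gadgetBlock v * tensorOp F).trace := by
  rw [Matrix.add_mul, Matrix.trace_add, trace_extendOp_mul_tensorOp,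
    Finset.prod_eq_zero (Finset.mem_univ (v, i)) hF, mul_zero, zero_add, gadgetOne_eq_sum,
    Finset.sum_mul, Matrix.trace_sum,
    Finset.sum_eq_single v (fun u _ hu => trace_gadgetBlock_eq_zero_of_ne hu i hF) (by simp)]

/-- Operators that act trivially on the ancillas see nothing of the gadgets. -/
theorem trace_extendOp_add_gadgetOne_of_one (K : QubitOp Q)
    {F : Q ⊕ Q × Fin 3 → Matrix (Fin 2) (Fin 2) ℂ} (hF : ∀ r, F (.inr r) = 1) :
    ((extendOp K + gadgetOne Q) * tensorOp F).trace
      = (K * tensorOp fun q => F (.inl q)).trace * 2 ^ Fintype.card (Q × Fin 3) := by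
  rw [Matrix.add_mul, Matrix.trace_add, trace_extendOp_mul_tensorOp, gadgetOne_eq_sum,
    Finset.sum_mul, Matrix.trace_sum,
    Finset.sum_eq_zero fun u _ => trace_gadgetBlock_eq_zero_of_one fun i => hF (u, i)]
  simp [hF]

/-- The traceless slot is put on the ancilla, so that `K` and the other blocks vanish; each
remaining term of the block has a Pauli matrix facing an identity. -/
theorem isolates_orig_ancA (K : QubitOp Q) (v : Q) :
    IsolatesCoupling (extendOp K + gadgetOne Q) ![-1, -1, -1] (orig v) (ancA v) := by
  intro F hF ht
  have hB : F (ancB v) = 1 := hF _ (by simp [orig, ancB]) (by simp [ancA, ancB])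
  have hC : F (ancC v) = 1 := hF _ (by simp [orig, ancC]) (by simp [ancA, ancC])
  rw [trace_extendOp_add_gadgetOne K v 0 ht, trace_gadgetBlock,
    trace_onQubit_mul_tensorOp_eq_zero_of_one _ (trace_pauli 0) hC,
    trace_onQubit_mul_tensorOp_eq_zero_of_one _ (trace_pauli 2) hC,
    trace_heisenberg_mul_tensorOp_eq_zero_of_right _ (ancA_ne_ancB v) hB,
    trace_heisenberg_mul_tensorOp_eq_zero_of_right _ (ancB_ne_ancC v) hC]
  simp

theorem isolates_ancA_ancB (K : QubitOp Q) (v : Q) :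
    IsolatesCoupling (extendOp K + gadgetOne Q) ![-3, -1, -2] (ancA v) (ancB v) := by
  intro F hF ht
  have hO : F (orig v) = 1 := hF _ (by simp [orig, ancA]) (by simp [orig, ancB])
  have hC : F (ancC v) = 1 := hF _ (by simp [ancA, ancC]) (by simp [ancB, ancC])
  rw [trace_extendOp_add_gadgetOne K v 1 ht, trace_gadgetBlock,
    trace_onQubit_mul_tensorOp_eq_zero_of_one _ (trace_pauli 0) hC,
    trace_onQubit_mul_tensorOp_eq_zero_of_one _ (trace_pauli 2) hC,
    trace_heisenberg_mul_tensorOp_eq_zero_of_left _ (orig_ne_ancA v) hO,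
    trace_heisenberg_mul_tensorOp_eq_zero_of_right _ (ancB_ne_ancC v) hC]
  simp

theorem isolates_ancB_ancA (K : QubitOp Q) (v : Q) :
    IsolatesCoupling (extendOp K + gadgetOne Q) ![-3, -1, -2] (ancB v) (ancA v) := by
  intro F hF ht
  have hO : F (orig v) = 1 := hF _ (by simp [orig, ancB]) (by simp [orig, ancA])
  have hC : F (ancC v) = 1 := hF _ (by simp [ancB, ancC]) (by simp [ancA, ancC])
  rw [trace_extendOp_add_gadgetOne K v 0 ht, trace_gadgetBlock,
    trace_onQubit_mul_tensorOp_eq_zero_of_one _ (trace_pauli 0) hC,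
    trace_onQubit_mul_tensorOp_eq_zero_of_one _ (trace_pauli 2) hC,
    trace_heisenberg_mul_tensorOp_eq_zero_of_left _ (orig_ne_ancA v) hO,
    trace_heisenberg_mul_tensorOp_eq_zero_of_right _ (ancB_ne_ancC v) hC,
    heisenberg_comm _ (ancA_ne_ancB v)]
  simp

/-- The traceless slot must be `ancB`: the field on `ancC` could survive a test that is traceless
only on `ancC`. -/
theorem isolates_ancC_ancB (K : QubitOp Q) (v : Q) :
    IsolatesCoupling (extendOp K + gadgetOne Q) ![-1, -1, -1] (ancC v) (ancB v) := by
  intro F hF ht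
  have hO : F (orig v) = 1 := hF _ (by simp [orig, ancC]) (by simp [orig, ancB])
  have hA : F (ancA v) = 1 := hF _ (by simp [ancA, ancC]) (by simp [ancA, ancB])
  rw [trace_extendOp_add_gadgetOne K v 1 ht, trace_gadgetBlock,
    trace_onQubit_mul_tensorOp_eq_zero _ _ (ancB_ne_ancC v) ht,
    trace_onQubit_mul_tensorOp_eq_zero _ _ (ancB_ne_ancC v) ht,
    trace_heisenberg_mul_tensorOp_eq_zero_of_left _ (orig_ne_ancA v) hO,
    trace_heisenberg_mul_tensorOp_eq_zero_of_left _ (ancA_ne_ancB v) hA,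
    heisenberg_comm _ (ancB_ne_ancC v)]
  simp

theorem trace_of_ancC (K : QubitOp Q) (v : Q)
    {F : Q ⊕ Q × Fin 3 → Matrix (Fin 2) (Fin 2) ℂ} (hF : ∀ r, r ≠ ancC v → F r = 1)
    (ht : (F (ancC v)).trace = 0) :
    ((extendOp K + gadgetOne Q) * tensorOp F).trace
      = 2 ^ (Fintype.card (Q ⊕ Q × Fin 3) - 1) *
        -((pauli 0 * F (ancC v)).trace + (pauli 2 * F (ancC v)).trace) := by
  have hA : F (ancA v) = 1 := hF _ (by simp [ancA, ancC])
  have hB : F (ancB v) = 1 := hF _ (by simp [ancB, ancC])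
  rw [trace_extendOp_add_gadgetOne K v 2 ht, trace_gadgetBlock,
    trace_onQubit_mul_tensorOp _ _ hF, trace_onQubit_mul_tensorOp _ _ hF,
    trace_heisenberg_mul_tensorOp_eq_zero_of_right _ (orig_ne_ancA v) hA,
    trace_heisenberg_mul_tensorOp_eq_zero_of_left _ (ancA_ne_ancB v) hA,
    trace_heisenberg_mul_tensorOp_eq_zero_of_left _ (ancB_ne_ancC v) hB]
  ring

/-- Testing with `|0⟩⟨1|` on `ancC` alone sees only the field: the real part gives the inequality,
the imaginary part the equation. -/
theorem bloch_ancC (K : QubitOp Q) (v : Q)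
    {u : Q ⊕ Q × Fin 3 → Matrix (Fin 2) (Fin 2) ℂ}
    (hu : ∀ q, u q ∈ Matrix.unitaryGroup (Fin 2) ℂ)
    (hs : GloballyStoquastic (tensorOp u * (extendOp K + gadgetOne Q) * (tensorOp u)ᴴ)) :
    0 ≤ bloch (u (ancC v)) 0 0 + bloch (u (ancC v)) 0 2 ∧
      bloch (u (ancC v)) 1 0 + bloch (u (ancC v)) 1 2 = 0 := by
  have key := hs.trace_mul_tensorOp_nonpos
    (update 1 (ancC v) (Matrix.single 0 (1 - 0) 1))
    (fun r b c => by
      by_cases hq : r = ancC v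
      · subst hq; simpa using single_nonneg 0 (1 - 0) _ _
      · simpa [hq] using one_apply_nonneg _ _)
    (ancC v) (fun b => by simpa using single_offDiag_apply_self 0 b)
  rw [trace_conj_mul_tensorOp, trace_of_ancC K v (fun r hr => by
      simpa [hr] using conj_one_of_mem_unitaryGroup (hu r)) (by
      rw [trace_conj_of_mem_unitaryGroup (hu _), update_self, trace_single_offDiag])] at key
  have key := le_of_mul_le_mul_left (key.trans (mul_zero _).ge) (pow_pos (by norm_num) _)
  rw [update_self, trace_conj_single_offDiag (hu _), trace_conj_single_offDiag (hu _)] at key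
  have key := Complex.nonpos_iff.mp key
  simp at key
  constructor <;> linarith

theorem bloch_mul_transpose {u : Matrix (Fin 2) (Fin 2) ℂ}
    (hu : u ∈ Matrix.unitaryGroup (Fin 2) ℂ) :
    (Matrix.of (bloch u) : Matrix (Fin 3) (Fin 3) ℝ) * (Matrix.of (bloch u))ᵀ = 1 := by
  ext m n
  simp [Matrix.mul_apply, Matrix.one_apply, bloch_orthonormal hu]

theorem rotatedCoupling_eq (α : Fin 3 → ℝ) (u v : Matrix (Fin 2) (Fin 2) ℂ) :
    Matrix.of (bloch u) * Matrix.diagonal α * (Matrix.of (bloch v))ᵀ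
      = Matrix.of (rotatedCoupling α u v) := by
  ext m n
  simp [Matrix.mul_apply, rotatedCoupling, Matrix.diagonal_apply, Fin.sum_univ_three]
  ring

theorem rotatedCoupling_comm (α : Fin 3 → ℝ) (u v : Matrix (Fin 2) (Fin 2) ℂ) (m n : Fin 3) :
    rotatedCoupling α u v m n = rotatedCoupling α v u n m :=
  Finset.sum_congr rfl fun k _ => by ring

/-- For the isotropic coupling, `O_p diag(α) O_qᵀ` is minus an orthogonal matrix. -/
theorem IsolatesCoupling.aligned {K : QubitOp Q} {p q : Q}
    (h : IsolatesCoupling K ![-1, -1, -1] p q) (hpq : p ≠ q)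
    {u : Q → Matrix (Fin 2) (Fin 2) ℂ} (hu : ∀ q, u q ∈ Matrix.unitaryGroup (Fin 2) ℂ)
    (hs : GloballyStoquastic (tensorOp u * K * (tensorOp u)ᴴ)) :
    bloch (u p) 0 = bloch (u q) 0 ∧
      (∃ s : ℝ, s ^ 2 = 1 ∧ bloch (u p) 1 = s • bloch (u q) 1) ∧
      ∃ s : ℝ, s ^ 2 = 1 ∧ bloch (u p) 2 = s • bloch (u q) 2 := by
  obtain ⟨h20, h21, h01, h10, h0⟩ := h.rotatedCoupling_apply hpq hu hs
  have hβ : ∀ m n, (Matrix.of (bloch (u p)) * (Matrix.of (bloch (u q)))ᵀ) m n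
      = -rotatedCoupling ![-1, -1, -1] (u p) (u q) m n := fun m n => by
    simp [Matrix.mul_apply, rotatedCoupling, Fin.sum_univ_three]
    ring
  refine aligned_of_rotatedCoupling (O := Matrix.of (bloch (u p))) (P := Matrix.of (bloch (u q)))
    (bloch_mul_transpose (hu p)) (bloch_mul_transpose (hu q)) rfl
    ?_ ?_ ?_ ?_ ?_
  · rw [hβ, h20, neg_zero]
  · rw [hβ, h21, neg_zero]
  · rw [hβ, h01, neg_zero]
  · rw [hβ, h10, neg_zero]
  · rw [hβ, hβ, abs_neg]; linarith

theorem bloch_orig (K : QubitOp Q) (v : Q)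
    {u : Q ⊕ Q × Fin 3 → Matrix (Fin 2) (Fin 2) ℂ}
    (hu : ∀ q, u q ∈ Matrix.unitaryGroup (Fin 2) ℂ)
    (hs : GloballyStoquastic (tensorOp u * (extendOp K + gadgetOne Q) * (tensorOp u)ᴴ)) :
    (bloch (u (orig v)) 0 = ![1, 0, 0] ∧
        ∃ s : ℝ, s ^ 2 = 1 ∧ bloch (u (orig v)) 2 = ![0, 0, s]) ∨
      (bloch (u (orig v)) 0 = ![0, 0, 1] ∧
        ∃ s : ℝ, s ^ 2 = 1 ∧ bloch (u (orig v)) 2 = ![s, 0, 0]) := by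
  obtain ⟨hUA0, -, hUA2⟩ := (isolates_orig_ancA K v).aligned (orig_ne_ancA v) hu hs
  obtain ⟨hCB0, hCB1, -⟩ := (isolates_ancC_ancB K v).aligned (ancB_ne_ancC v).symm hu hs
  obtain ⟨hC0, hC1⟩ := bloch_ancC K v hu hs
  obtain ⟨h20, h21, h01, h10, h0⟩ :=
    (isolates_ancA_ancB K v).rotatedCoupling_apply (ancA_ne_ancB v) hu hs
  -- This coupling is not orthogonal, so the last column must be cleared separately, by exchanging
  -- the two qubits and transposing.
  obtain ⟨k20, k21, -, -, -⟩ :=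
    (isolates_ancB_ancA K v).rotatedCoupling_apply (ancA_ne_ancB v).symm hu hs
  rw [rotatedCoupling_comm] at k20 k21
  refine rows_of_gadget (U := Matrix.of (bloch (u (orig v)))) (A := Matrix.of (bloch (u (ancA v))))
    (B := Matrix.of (bloch (u (ancB v)))) (C := Matrix.of (bloch (u (ancC v))))
    (bloch_mul_transpose (hu _)) (bloch_mul_transpose (hu _)) (bloch_mul_transpose (hu _))
    hUA0 hUA2 hCB0 hCB1 hC0 hC1
    (r := fun m => rotatedCoupling ![-3, -1, -2] (u (ancA v)) (u (ancB v)) m m) ?_ h0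
  rw [rotatedCoupling_eq]
  ext m n
  fin_cases m <;> fin_cases n <;> simp [h20, h21, h01, h10, k20, k21]

/-- The single-qubit unitaries on the original qubits are, up to a phase and a bit flip, `I` or
`W`. -/
theorem conj_pauli_orig (K : QubitOp Q) (v : Q)
    {u : Q ⊕ Q × Fin 3 → Matrix (Fin 2) (Fin 2) ℂ}
    (hu : ∀ q, u q ∈ Matrix.unitaryGroup (Fin 2) ℂ)
    (hs : GloballyStoquastic (tensorOp u * (extendOp K + gadgetOne Q) * (tensorOp u)ᴴ)) :
    ∃ (x : Fin 2) (π : Equiv.Perm (Fin 2)),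
      (x = 0 → bloch (u (orig v)) 0 = ![1, 0, 0] ∧
        ∃ s : ℝ, s ^ 2 = 1 ∧ bloch (u (orig v)) 2 = ![0, 0, s]) ∧
      (x = 1 → bloch (u (orig v)) 0 = ![0, 0, 1] ∧
        ∃ s : ℝ, s ^ 2 = 1 ∧ bloch (u (orig v)) 2 = ![s, 0, 0]) ∧
      ∀ i j, (u (orig v))ᴴ * Matrix.single i j 1 * u (orig v)
        = (hadamardW ^ (x : ℕ)) * Matrix.single (π i) (π j) 1 * hadamardW ^ (x : ℕ) := by
  have hX := conj_pauli_eq_sum (hu (orig v)) 0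
  have hZ := conj_pauli_eq_sum (hu (orig v)) 2
  rcases bloch_orig K v hu hs with h | h
  · obtain ⟨h0, s, hs2, h2⟩ := id h
    obtain ⟨π, hπ⟩ := exists_perm_conj_single (hu (orig v)) (hadamardW_pow_mem_unitaryGroup 0)
      (s := s) (by exact_mod_cast mul_self_eq_one_iff.mp ((sq s).symm.trans hs2))
      (by rw [hX, h0]; simp [Fin.sum_univ_three]) (by rw [hZ, h2]; simp [Fin.sum_univ_three])
    refine ⟨0, π, fun _ => h, by simp, fun i j => ?_⟩
    rw [hπ, hadamardW_pow_isHermitian]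
  · obtain ⟨h0, s, hs2, h2⟩ := id h
    obtain ⟨π, hπ⟩ := exists_perm_conj_single (hu (orig v)) (hadamardW_pow_mem_unitaryGroup 1)
      (s := s) (by exact_mod_cast mul_self_eq_one_iff.mp ((sq s).symm.trans hs2))
      (by
        rw [hX, h0, hadamardW_pow_isHermitian]
        simp [Fin.sum_univ_three, pauli, hadamardW_conj_pauliX])
      (by
        rw [hZ, h2, hadamardW_pow_isHermitian]
        simp [Fin.sum_univ_three, pauli, hadamardW_conj_pauliZ])
    refine ⟨1, π, by simp, fun _ => h, fun i j => ?_⟩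
    rw [hπ, hadamardW_pow_isHermitian]

end Isolation

/-! ### The second gadget excludes Hadamards on the last `l` original qubits -/

section GadgetTwo

open Function

theorem isolates_gadgetTwo {n l : ℕ} (H : QubitOp (Fin (n + l))) (j : Fin l) :
    IsolatesCoupling (hamHad H) ![-1, 0, 1] (.inl (.inl (Fin.natAdd n j))) (.inl (.inr j)) := by
  intro F hF ht
  have h1 : ∀ r, F (.inr r) = 1 := fun r => hF _ (by simp) (by simp)
  rw [hamHad, trace_extendOp_add_gadgetOne_of_one _ h1, ← extendOp_heisenberg,
    trace_extendOp_mul_tensorOp, Matrix.add_mul, Matrix.trace_add, trace_extendOp_mul_tensorOp,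
    Finset.prod_eq_zero (Finset.mem_univ j) ht, mul_zero, zero_add, gadgetTwo_eq_sum,
    Finset.sum_mul, Matrix.trace_sum, Finset.sum_eq_single j]
  · simp [h1]
  · intro i _ hij
    exact trace_heisenberg_mul_tensorOp_eq_zero (r := .inr j) _ (by simp) (by simp)
      (by simpa using hij.symm) ht
  · simp

/-- If only the first qubit is rotated, a forbidden `ZX` term `∓1` appears; if both are, `XX`
acquires the coefficient `+1`. -/
theorem not_rotated_of_gadgetTwo {u v : Matrix (Fin 2) (Fin 2) ℂ}
    (h0 : rotatedCoupling ![-1, 0, 1] u v 2 0 = 0)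
    (h1 : rotatedCoupling ![-1, 0, 1] u v 0 0 ≤ -|rotatedCoupling ![-1, 0, 1] u v 1 1|)
    (hu0 : bloch u 0 = ![0, 0, 1]) (hu2 : ∃ s : ℝ, s ^ 2 = 1 ∧ bloch u 2 = ![s, 0, 0])
    (hv : bloch v 0 = ![1, 0, 0] ∨ bloch v 0 = ![0, 0, 1]) : False := by
  obtain ⟨s, hs, hu2⟩ := hu2
  rcases hv with hv | hv
  · have : s = 0 := by simpa [rotatedCoupling, Fin.sum_univ_three, hu2, hv] using h0
    rw [this] at hs
    norm_num at hs
  · have h2 := h1.trans (neg_nonpos.mpr (abs_nonneg _))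
    simp [rotatedCoupling, Fin.sum_univ_three, hu0, hv] at h2
    linarith

end GadgetTwo

/-! ### From a product unitary to a Hadamard pattern -/

section Forward

open scoped ComplexOrder

theorem tensorOp_single {Q : Type*} [Fintype Q] [DecidableEq Q] (a b : Q → Fin 2) :
    tensorOp (fun q => Matrix.single (a q) (b q) (1 : ℂ)) = Matrix.single a b 1 := by
  ext x y
  simp only [tensorOp, Matrix.of_apply, Matrix.single_apply, Finset.prod_ite_zero,
    Finset.prod_const_one, Finset.mem_univ, true_implies, forall_and, funext_iff]

theorem hadamardPattern_conjTranspose {Q : Type*} [Fintype Q] (x : Q → Fin 2) :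
    (hadamardPattern x)ᴴ = hadamardPattern x := by
  rw [hadamardPattern, tensorOp_conjTranspose]
  simp only [hadamardW_pow_isHermitian]

theorem exists_pattern_of_globallyStoquastic {n l : ℕ} {H : QubitOp (Fin (n + l))}
    (hH : H.IsHermitian) {u : HadQubits n l → Matrix (Fin 2) (Fin 2) ℂ}
    (hu : ∀ q, u q ∈ Matrix.unitaryGroup (Fin 2) ℂ)
    (hs : GloballyStoquastic (tensorOp u * hamHad H * (tensorOp u)ᴴ)) :
    ∃ x : Fin n → Fin 2,
      GloballyStoquastic
        ((hadamardPattern (Fin.append x (fun _ : Fin l => 0)))ᴴ * H *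
          hadamardPattern (Fin.append x (fun _ : Fin l => 0))) := by
  choose x π hx0 hx1 hπ using fun v => conj_pauli_orig _ v hu hs
  -- The qubit `d_j` also carries a first gadget, so its unitary too is of type `I` or `W`, and both
  -- cases are contradictory.
  have hd : ∀ j : Fin l, x (.inl (Fin.natAdd n j)) = 0 := by
    intro j
    by_contra hne
    obtain ⟨h20, -, -, -, h00⟩ :=
      (isolates_gadgetTwo H j).rotatedCoupling_apply (by simp) hu hs
    have h1 := hx1 _ (show x (.inl (Fin.natAdd n j)) = 1 by omega)
    refine not_rotated_of_gadgetTwo h20 h00 h1.1 h1.2 ?_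
    by_cases h : x (.inr j) = 0
    · exact .inl (hx0 _ h).1
    · exact .inr (hx1 _ (show x (.inr j) = 1 by omega)).1
  have hy : Fin.append (fun i => x (.inl (Fin.castAdd l i))) (fun _ : Fin l => (0 : Fin 2))
      = fun v => x (.inl v) := by
    ext v
    induction v using Fin.addCases with
    | left i => simp
    | right j => simp [hd]
  refine ⟨fun i => x (.inl (Fin.castAdd l i)), ?_⟩
  rw [hy, globallyStoquastic_iff (Matrix.isHermitian_conjTranspose_mul_mul _ hH)]
  intro a b hab
  obtain ⟨q, hq⟩ := Function.ne_iff.mp hab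
  set w : Fin (n + l) → Fin 2 := fun v => x (.inl v) with hw
  have h1 : ((hadamardPattern w)ᴴ * H * hadamardPattern w) a b
      = (H * tensorOp fun v =>
        hadamardW ^ (w v : ℕ) * Matrix.single (b v) (a v) 1 * hadamardW ^ (w v : ℕ)).trace := by
    have h := trace_conj_mul_tensorOp (fun v => hadamardW ^ (w v : ℕ))
      (fun v => Matrix.single (b v) (a v) 1) H
    simp only [hadamardW_pow_isHermitian] at h
    rw [← h, tensorOp_single, Matrix.trace_mul_single]
    -- `Matrix.trace_mul_single` leaves the entry `1` as a right scalar action.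
    change ((hadamardPattern w)ᴴ * H * hadamardPattern w) a b
      = MulOpposite.op 1 • (hadamardPattern w * H * (hadamardPattern w)ᴴ) a b
    rw [hadamardPattern_conjTranspose]
    simp
  rw [h1]
  -- The labels are pulled back along the bit flips `π`, so that conjugation by `u` produces exactly
  -- the units `|b⟩⟨a|` conjugated by `W`. Identities on all ancillas remove both gadgets.
  have key := hs.trace_mul_tensorOp_nonpos
    (Sum.elim (Sum.elim (fun v => Matrix.single ((π (.inl v)).symm (b v))
      ((π (.inl v)).symm (a v)) 1) 1) 1)
    (by
      rintro ((v | j) | r) i k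
      · exact single_nonneg _ _ _ _
      · exact one_apply_nonneg _ _
      · exact one_apply_nonneg _ _)
    (.inl (.inl q)) (fun i => by
      simp only [Sum.elim_inl, Matrix.single_apply]
      rw [if_neg]
      rintro ⟨h2, h3⟩
      exact hq ((π (.inl q)).symm.injective (h3.trans h2.symm)))
  rw [trace_conj_mul_tensorOp, hamHad, trace_extendOp_add_gadgetOne_of_one _ (fun r => by
      simpa using conj_one_of_mem_unitaryGroup (hu _)), Matrix.add_mul, Matrix.trace_add,
    trace_extendOp_mul_tensorOp, gadgetTwo_eq_sum, Finset.sum_mul, Matrix.trace_sum,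
    Finset.sum_eq_zero fun j _ => trace_heisenberg_mul_tensorOp_eq_zero_of_right _ (by simp) (by
      simpa using conj_one_of_mem_unitaryGroup (hu _)), add_zero, mul_assoc] at key
  have hπ' : ∀ v i k, (u (.inl (.inl v)))ᴴ * Matrix.single i k 1 * u (.inl (.inl v))
      = (hadamardW ^ (w v : ℕ)) * Matrix.single (π (.inl v) i) (π (.inl v) k) 1 *
        hadamardW ^ (w v : ℕ) := fun v => hπ (.inl v)
  have hone : ∀ q, ((u q)ᴴ * u q).trace = 2 := fun q => by
    rw [← Matrix.star_eq_conjTranspose, Matrix.mem_unitaryGroup_iff'.mp (hu q)]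
    simp
  simp only [Sum.elim_inl, Sum.elim_inr, hπ', Equiv.apply_symm_apply, Pi.one_apply, mul_one,
    hone, Finset.prod_const, ← pow_add] at key
  rw [mul_comm] at key
  exact le_of_mul_le_mul_left (key.trans (mul_zero _).ge) (pow_pos (by norm_num) _)

end Forward

/-! ### From a Hadamard pattern to a product unitary -/

section Backward

open Function

theorem GloballyStoquastic.add {Q : Type*} {A B : QubitOp Q} (hA : GloballyStoquastic A)
    (hB : GloballyStoquastic B) : GloballyStoquastic (A + B) :=
  ⟨fun x y => by simp [hA.1 x y, hB.1 x y], fun x y h => by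
    simpa using add_nonpos (hA.2 x y h) (hB.2 x y h)⟩

theorem GloballyStoquastic.sum {Q ι : Type*} {A : ι → QubitOp Q} (s : Finset ι)
    (hA : ∀ i ∈ s, GloballyStoquastic (A i)) : GloballyStoquastic (∑ i ∈ s, A i) :=
  ⟨fun x y => by
    rw [Matrix.sum_apply, Complex.im_sum]; exact Finset.sum_eq_zero fun i hi => (hA i hi).1 x y,
   fun x y h => by
    rw [Matrix.sum_apply, Complex.re_sum]; exact Finset.sum_nonpos fun i hi => (hA i hi).2 x y h⟩

theorem GloballyStoquastic.extendOp {Q R : Type*} [Fintype R] [DecidableEq R] {A : QubitOp Q}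
    (hA : GloballyStoquastic A) : GloballyStoquastic (extendOp A : QubitOp (Q ⊕ R)) := by
  refine ⟨fun x y => ?_, fun x y h => ?_⟩ <;> rw [extendOp_apply, Matrix.one_apply] <;>
    split_ifs with hr
  · simpa using hA.1 _ _
  · simp
  · rw [mul_one]
    refine hA.2 _ _ fun hq => h ?_
    ext (q | r) : 1
    · exact congrFun hq q
    · exact congrFun hr r
  · simp

variable {Q : Type*} [Fintype Q] [DecidableEq Q]

theorem onQubit_apply (A : Matrix (Fin 2) (Fin 2) ℂ) (q : Q) (x y : Q → Fin 2) :
    onQubit A q x y = if ∀ r, r ≠ q → x r = y r then A (x q) (y q) else 0 := by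
  simp only [onQubit, tensorOp, Matrix.of_apply]
  split_ifs with h
  · rw [Finset.prod_eq_single q (fun r _ hr => by simp [hr, h r hr]) (by simp), update_self]
  · push Not at h
    obtain ⟨r, hr, hxy⟩ := h
    exact Finset.prod_eq_zero (Finset.mem_univ r) (by simp [hr, hxy])

theorem onQubit_mul_onQubit_apply (A B : Matrix (Fin 2) (Fin 2) ℂ) {p q : Q} (hpq : p ≠ q)
    (x y : Q → Fin 2) :
    (onQubit A p * onQubit B q) x y
      = if ∀ r, r ≠ p → r ≠ q → x r = y r then A (x p) (y p) * B (x q) (y q) else 0 := by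
  rw [onQubit_mul_onQubit _ _ hpq, tensorOp, Matrix.of_apply]
  split_ifs with h
  · rw [Finset.prod_eq_mul p q hpq (fun r _ hr => by simp [hr.1, hr.2, h r hr.1 hr.2]) (by simp)
      (by simp)]
    simp [hpq]
  · push Not at h
    obtain ⟨r, hp, hq, hxy⟩ := h
    exact Finset.prod_eq_zero (Finset.mem_univ r) (by simp [hp, hq, hxy])

/-- `ZZ` is diagonal, while `XX` and `YY` flip the same two bits with real amplitudes; the
off-diagonal entries are `α₀ ± α₁` or zero. -/
theorem globallyStoquastic_heisenberg {α : Fin 3 → ℝ} (h : α 0 ≤ -|α 1|) {p q : Q}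
    (hpq : p ≠ q) : GloballyStoquastic (heisenberg α p q) := by
  have h1 := abs_le.mp (le_neg.mp h)
  have key : ∀ a b c d : Fin 2, (∑ k, (α k : ℂ) * (pauli k a b * pauli k c d)).im = 0 ∧
      (¬(a = b ∧ c = d) → (∑ k, (α k : ℂ) * (pauli k a b * pauli k c d)).re ≤ 0) := by
    intro a b c d
    fin_cases a <;> fin_cases b <;> fin_cases c <;> fin_cases d <;>
      simp [Fin.sum_univ_three, pauli, pauliX, pauliY, pauliZ] <;> linarith
  have entry : ∀ x y, heisenberg α p q x y = if ∀ r, r ≠ p → r ≠ q → x r = y r then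
      ∑ k, (α k : ℂ) * (pauli k (x p) (y p) * pauli k (x q) (y q)) else 0 := by
    intro x y
    simp only [heisenberg, Matrix.sum_apply, Matrix.smul_apply,
      onQubit_mul_onQubit_apply _ _ hpq, smul_eq_mul]
    split_ifs <;> simp
  refine ⟨fun x y => ?_, fun x y hxy => ?_⟩ <;> rw [entry] <;> split_ifs with hr
  · exact (key _ _ _ _).1
  · rfl
  · refine (key _ _ _ _).2 fun hc => hxy ?_
    ext r : 1
    by_cases hp : r = p
    · rw [hp]; exact hc.1
    · by_cases hq : r = q
      · rw [hq]; exact hc.2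
      · exact hr r hp hq
  · rfl

theorem globallyStoquastic_field (q : Q) :
    GloballyStoquastic (-(onQubit (pauli 0) q + onQubit (pauli 2) q)) := by
  have key : ∀ a b : Fin 2, (-(pauli 0 a b + pauli 2 a b)).im = 0 ∧
      (a ≠ b → (-(pauli 0 a b + pauli 2 a b)).re ≤ 0) := by
    intro a b
    fin_cases a <;> fin_cases b <;> simp [pauli, pauliX, pauliZ]
  have entry : ∀ x y, (-(onQubit (pauli 0) q + onQubit (pauli 2) q)) x y
      = if ∀ r, r ≠ q → x r = y r then
        -(pauli 0 (x q) (y q) + pauli 2 (x q) (y q)) else 0 := by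
    intro x y
    rw [Matrix.neg_apply, Matrix.add_apply, onQubit_apply, onQubit_apply]
    split_ifs <;> simp
  refine ⟨fun x y => ?_, fun x y hxy => ?_⟩ <;> rw [entry] <;> split_ifs with hr
  · exact (key _ _).1
  · rfl
  · refine (key _ _).2 fun hc => hxy ?_
    ext r : 1
    by_cases hq : r = q
    · rw [hq]; exact hc
    · exact hr r hq
  · rfl

theorem hadamardPattern_conj_onQubit (y : Q → Fin 2) (A : Matrix (Fin 2) (Fin 2) ℂ) (q : Q) :
    hadamardPattern y * onQubit A q * (hadamardPattern y)ᴴ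
      = onQubit (hadamardW ^ (y q : ℕ) * A * hadamardW ^ (y q : ℕ)) q := by
  rw [hadamardPattern, tensorOp_conj_onQubit _ fun q => hadamardW_pow_mem_unitaryGroup _,
    hadamardW_pow_isHermitian]

theorem onQubit_neg (A : Matrix (Fin 2) (Fin 2) ℂ) (q : Q) : onQubit (-A) q = -onQubit A q := by
  ext x y
  rw [Matrix.neg_apply, onQubit_apply, onQubit_apply]
  split_ifs <;> simp

theorem hadamardPattern_conj_mul (y : Q → Fin 2) (A B : QubitOp Q) :
    hadamardPattern y * (A * B) * (hadamardPattern y)ᴴ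
      = (hadamardPattern y * A * (hadamardPattern y)ᴴ) *
        (hadamardPattern y * B * (hadamardPattern y)ᴴ) := by
  have h : (hadamardPattern y)ᴴ * hadamardPattern y = 1 :=
    tensorOp_mem_unitary _ fun q => hadamardW_pow_mem_unitaryGroup _
  calc hadamardPattern y * (A * B) * (hadamardPattern y)ᴴ
      = hadamardPattern y * A * 1 * B * (hadamardPattern y)ᴴ := by simp only [mul_assoc, mul_one]
    _ = _ := by rw [← h]; simp only [mul_assoc]

/-- `W` swaps `X` and `Z`, and the sign in `Y ↦ -Y` occurs twice. -/
theorem hadamardPattern_conj_heisenberg (y : Q → Fin 2) (α : Fin 3 → ℝ) {p q : Q}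
    (h : y p = y q) :
    hadamardPattern y * heisenberg α p q * (hadamardPattern y)ᴴ
      = heisenberg (if y p = 0 then α else ![α 2, α 1, α 0]) p q := by
  simp only [heisenberg, Finset.mul_sum, Finset.sum_mul, Matrix.mul_smul, Matrix.smul_mul,
    hadamardPattern_conj_mul, hadamardPattern_conj_onQubit, ← h]
  split_ifs with h0
  · simp [h0]
  · have h1 : y p = 1 := by omega
    simp only [h1, Fin.sum_univ_three, pauli]
    simp [hadamardW_conj_pauliX, hadamardW_conj_pauliY, hadamardW_conj_pauliZ, onQubit_neg]
    abel

theorem globallyStoquastic_conj_gadgetBlock {y : Q ⊕ Q × Fin 3 → Fin 2} {u : Q}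
    (h : ∀ i, y (.inr (u, i)) = y (.inl u)) :
    GloballyStoquastic (hadamardPattern y * gadgetBlock u * (hadamardPattern y)ᴴ) := by
  have hO : y (orig u) = y (.inl u) := rfl
  have hA : y (ancA u) = y (.inl u) := h 0
  have hB : y (ancB u) = y (.inl u) := h 1
  have hC : y (ancC u) = y (.inl u) := h 2
  have hf : hadamardPattern y * -(onQubit (pauli 0) (ancC u) + onQubit (pauli 2) (ancC u)) *
      (hadamardPattern y)ᴴ = -(onQubit (pauli 0) (ancC u) + onQubit (pauli 2) (ancC u)) := by
    simp only [mul_neg, neg_mul, Matrix.mul_add, Matrix.add_mul, hadamardPattern_conj_onQubit, hC]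
    by_cases h0 : y (.inl u) = 0
    · simp [h0]
    · have h1 : y (.inl u) = 1 := by omega
      simp [h1, pauli, hadamardW_conj_pauliX, hadamardW_conj_pauliZ, add_comm]
  rw [gadgetBlock]
  simp only [Matrix.mul_add, Matrix.add_mul] at hf ⊢
  rw [hadamardPattern_conj_heisenberg y _ (hO.trans hA.symm),
    hadamardPattern_conj_heisenberg y _ (hA.trans hB.symm),
    hadamardPattern_conj_heisenberg y _ (hB.trans hC.symm), hf]
  refine (((globallyStoquastic_field _).add (globallyStoquastic_heisenberg ?_ (orig_ne_ancA u))).add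
    (globallyStoquastic_heisenberg ?_ (ancA_ne_ancB u))).add
    (globallyStoquastic_heisenberg ?_ (ancB_ne_ancC u))
  -- The weights `(-3, -1, -2)` pass in both cases because the `Y` weight is smallest in absolute
  -- value, so swapping the `X` and `Z` weights is harmless.
  all_goals split_ifs <;> simp

theorem hadamardPattern_conj_extendOp {R : Type*} [Fintype R] [DecidableEq R] (K : QubitOp Q)
    (y : Q ⊕ R → Fin 2) :
    hadamardPattern y * extendOp K * (hadamardPattern y)ᴴ
      = extendOp (hadamardPattern (fun q => y (.inl q)) * K *
          (hadamardPattern fun q => y (.inl q))ᴴ) :=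
  tensorOp_conj_extendOp K _ fun _ => hadamardW_pow_mem_unitaryGroup _

theorem globallyStoquastic_conj_hamHad {n l : ℕ} {H : QubitOp (Fin (n + l))}
    {x : Fin (n + l) → Fin 2} (hx : ∀ j : Fin l, x (Fin.natAdd n j) = 0)
    (hs : GloballyStoquastic (hadamardPattern x * H * (hadamardPattern x)ᴴ)) :
    ∃ U : QubitOp (HadQubits n l),
      IsProductUnitary U ∧ GloballyStoquastic (U * hamHad H * Uᴴ) := by
  -- Each `d_j` is left unrotated, and `a_u, b_u, c_u` copy the exponent of `u`.
  let z : Fin (n + l) ⊕ Fin l → Fin 2 := Sum.elim x fun _ => 0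
  let y : HadQubits n l → Fin 2 := Sum.elim z fun r => z r.1
  refine ⟨hadamardPattern y, ⟨_, fun q => hadamardW_pow_mem_unitaryGroup _, rfl⟩, ?_⟩
  rw [hamHad, Matrix.mul_add, Matrix.add_mul, hadamardPattern_conj_extendOp, gadgetOne_eq_sum,
    Finset.mul_sum, Finset.sum_mul]
  refine .add (.extendOp ?_) (.sum _ fun u _ => globallyStoquastic_conj_gadgetBlock fun i => rfl)
  change GloballyStoquastic (hadamardPattern z * (extendOp H + gadgetTwo n l) *
    (hadamardPattern z)ᴴ)
  rw [Matrix.mul_add, Matrix.add_mul, hadamardPattern_conj_extendOp, gadgetTwo_eq_sum,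
    Finset.mul_sum, Finset.sum_mul]
  refine .add (.extendOp hs) (.sum _ fun j _ => ?_)
  have hj : z (.inl (Fin.natAdd n j)) = 0 := hx j
  rw [hadamardPattern_conj_heisenberg z _ (hj.trans rfl), if_pos hj]
  exact globallyStoquastic_heisenberg (by norm_num) (by simp)

end Backward

/-- For a Hamiltonian `H` on `n + l` qubits, `H_Had` can be made globally stoquastic by a product
of single-qubit unitaries iff `W(x0^l)† H W(x0^l)` is globally stoquastic for some
`x ∈ {0,1}^n`. -/
theorem lemma7 (n l : ℕ) (H : QubitOp (Fin (n + l))) (hH : H.IsHermitian) :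
    (∃ U : QubitOp (HadQubits n l),
        IsProductUnitary U ∧ GloballyStoquastic (U * hamHad H * Uᴴ)) ↔
      ∃ x : Fin n → Fin 2,
        GloballyStoquastic
          ((hadamardPattern (Fin.append x (fun _ : Fin l => 0)))ᴴ * H *
            hadamardPattern (Fin.append x (fun _ : Fin l => 0))) := by
  constructor
  · rintro ⟨U, ⟨u, hu, rfl⟩, hs⟩
    exact exists_pattern_of_globallyStoquastic hH hu hs
  · rintro ⟨x, hs⟩
    refine globallyStoquastic_conj_hamHad (x := Fin.append x fun _ => 0) (fun j => by simp) ?_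
    rwa [hadamardPattern_conjTranspose] at hs ⊢
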